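/- **Theorem 1.** For $\alpha\in(0,2)$ and $u:\mathbb R\to\mathbb C$ let $$(-\Delta)^{\alpha/2}u(x)=c_\alpha\,\mathrm{p.v.}\!\int_{-\infty}^{\infty}\frac{u(x)-u(x+y)}{|y|^{1+\alpha}}\,dy,\qquad c_\alpha=\alpha\,\frac{2^{\alpha-1}\Gamma(1/2+\alpha/2)}{\sqrt\pi\,\Gamma(1-\alpha/2)},$$ where the principal value is the limit as $\varepsilon\to0^+$ of the (absolutely convergent) integrals over $|y|>\varepsilon$. Let $L>0$, $k\in\mathbb Z$, and regard $e^{iks}$ as the function of $x\in\mathbb R$ obtained through the bijection $x=L\cot(s)$, $s\in(0,\pi)$, that is, $s=\arccos\bigl(x/\sqrt{L^2+x^2}\bigr)$. Let $s\in(0,\pi)$. Then the fractional Laplacians below, taken in the variable $x$ and evaluated at $x=L\cot(s)$, exist, all series converge absolutely, and the following holds. If $\alpha\in(0,1)\cup(1,2)$, then $$(-\Delta)^{\alpha/2}(e^{iks})=\begin{cases}\displaystyle\frac{c_\alpha|\sin(s)|^{\alpha-1}}{8L^\alpha\tan(\frac{\pi\alpha}{2})}\sum_{l=-\infty}^{\infty}e^{i2ls}\bigl((1-\alpha)k^2-4kl\bigr)G_{k,l},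 & k\text{ even},\\[3mm]\displaystyle i\,\frac{c_\alpha|\sin(s)|^{\alpha-1}}{8L^\alpha}\sum_{l=-\infty}^{\infty}e^{i2ls}\bigl((1-\alpha)k^2-4kl\bigr)\,\mathrm{sgn}\bigl(\tfrac k2-l\bigr)G_{k,l}, & k\text{ odd},\end{cases}$$ where $$G_{k,l}=\frac{\Gamma\left(\frac{-1+\alpha}{2}+|l|\right)\Gamma\left(\frac{-1-\alpha}{2}+\left|\frac k2-l\right|\right)}{\Gamma\left(\frac{3-\alpha}{2}+|l|\right)\Gamma\left(\frac{3+\alpha}{2}+\left|\frac k2-l\right|\right)}.$$ Moreover, when $\alpha=1$, $$(-\Delta)^{1/2}(e^{iks})=\begin{cases}\displaystyle\frac{|k|\sin^2(s)}{L}\,e^{iks}, & k\text{ even},\\[3mm]\displaystyle\frac{ik}{L\pi}\left(\frac{-2}{k^2-4}-\sum_{l=-\infty}^{\infty}\frac{4\,\mathrm{sgn}(l)\,e^{i2ls}}{(k-2l)\bigl((k-2l)^2-4\bigr)}\right), & k\text{ odd}.\end{cases}$$ -/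

import Mathlib

open MeasureTheory Filter Topology

noncomputable section

/-- The normalizing constant `c_α = α 2^(α-1) Γ(1/2 + α/2) / (√π Γ(1 - α/2))`. -/
def fracConst (α : ℝ) : ℝ :=
  α * (2 ^ (α - 1) * Real.Gamma (1 / 2 + α / 2)) / (√Real.pi * Real.Gamma (1 - α / 2))

/-- The integrand `(u(x) - u(x+y)) / |y|^(1+α)` of the singular integral. -/
def fracIntegrand (α : ℝ) (u : ℝ → ℂ) (x y : ℝ) : ℂ :=
  (u x - u (x + y)) / ((|y| ^ (1 + α) : ℝ) : ℂ)

/-- `(-Δ)^(α/2) u (x)` exists and equals `v`, where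
`(-Δ)^(α/2) u (x) = c_α ∫ (u(x) - u(x+y)) / |y|^(1+α) dy` is a principal value at `y = 0`:
all truncated integrals over `{|y| > ε}` converge absolutely, and their limit as `ε → 0⁺`,
multiplied by `c_α`, is `v`. -/
def HasFracLaplacianAt (α : ℝ) (u : ℝ → ℂ) (x : ℝ) (v : ℂ) : Prop :=
  (∀ ε : ℝ, 0 < ε → IntegrableOn (fracIntegrand α u x) {y : ℝ | ε < |y|}) ∧
    Tendsto (fun ε : ℝ => (fracConst α : ℂ) * ∫ y in {y : ℝ | ε < |y|}, fracIntegrand α u x y)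
      (𝓝[>] 0) (𝓝 v)

/-- The inverse `s = arccos (x / √(L² + x²))` of the map `s ↦ x = L cot s` from `(0, π)`
onto `ℝ`. -/
def angle (L x : ℝ) : ℝ := Real.arccos (x / √(L ^ 2 + x ^ 2))

/-- The angle really inverts the change of variable. -/
theorem angle_cot {L s : ℝ} (hL : 0 < L) (hs : s ∈ Set.Ioo 0 Real.pi) :
    angle L (L * Real.cot s) = s := by
  have hsin : 0 < Real.sin s := Real.sin_pos_of_mem_Ioo hs
  have h1 : L ^ 2 + (L * Real.cot s) ^ 2 = (L / Real.sin s) ^ 2 := by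
    rw [Real.cot_eq_cos_div_sin]
    field_simp
    exact Real.sin_sq_add_cos_sq s
  have h2 : L * Real.cot s / √(L ^ 2 + (L * Real.cot s) ^ 2) = Real.cos s := by
    rw [h1, Real.sqrt_sq (by positivity), Real.cot_eq_cos_div_sin]
    field_simp
  rw [angle, h2, Real.arccos_cos hs.1.le hs.2.le]

/-- The Fourier mode `e^{iks}` as a function of `x = L cot s ∈ ℝ`. -/
def fourierMode (L : ℝ) (k : ℤ) (x : ℝ) : ℂ :=
  Complex.exp (Complex.I * k * (angle L x : ℂ))

/-- The quotient of four Gamma functions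
`Γ((-1+α)/2 + |l|) Γ((-1-α)/2 + |k/2-l|) / (Γ((3-α)/2 + |l|) Γ((3+α)/2 + |k/2-l|))`. -/
def gammaRatio (α : ℝ) (k l : ℤ) : ℝ :=
  (Real.Gamma ((-1 + α) / 2 + |(l : ℝ)|) * Real.Gamma ((-1 - α) / 2 + |(k : ℝ) / 2 - l|)) /
    (Real.Gamma ((3 - α) / 2 + |(l : ℝ)|) * Real.Gamma ((3 + α) / 2 + |(k : ℝ) / 2 - l|))

/-- The terms of the series for even `k` and `α ≠ 1`. -/
def evenTerm (α : ℝ) (k : ℤ) (s : ℝ) (l : ℤ) : ℂ :=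
  Complex.exp (Complex.I * 2 * l * s) *
    (((1 - α) * (k : ℝ) ^ 2 - 4 * k * l : ℝ) : ℂ) * (gammaRatio α k l : ℂ)

/-- The terms of the series for odd `k` and `α ≠ 1`. -/
def oddTerm (α : ℝ) (k : ℤ) (s : ℝ) (l : ℤ) : ℂ :=
  Complex.exp (Complex.I * 2 * l * s) *
    (((1 - α) * (k : ℝ) ^ 2 - 4 * k * l : ℝ) : ℂ) *
    (Real.sign ((k : ℝ) / 2 - l) : ℂ) * (gammaRatio α k l : ℂ)

/-- The terms of the series for odd `k` and `α = 1`. -/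
def oddTermOne (k : ℤ) (s : ℝ) (l : ℤ) : ℂ :=
  4 * (Real.sign (l : ℝ) : ℂ) * Complex.exp (Complex.I * 2 * l * s) /
    (((k : ℂ) - 2 * l) * (((k : ℂ) - 2 * l) ^ 2 - 4))

end

/-!
Write `u = e^{iks}` as a function of `x = L cot s`. Pairing `y` with `-y` turns the truncated
principal value into an integral of the second difference `2 u(x) - u(x+y) - u(x-y)` against
`y^(-1-α)`, and two integrations by parts turn that into the absolutely convergent integral
`∫ u''(z) Ψ(|z - x|) dz`, where `Ψ'' = -y^(-1-α)`: `Ψ = y^(1-α) / (α (1-α))` for `α ≠ 1` and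
`Ψ = log` for `α = 1` (`hasFracLaplacianAt_of_kernel`). All boundary terms vanish because `u''` is
bounded and `u' = O(x^(-2))`.

After the substitution `z = L cot t` the distance `|z - x|` becomes
`L |sin(s - t)| / (sin s sin t)`, so the integral is a convolution over a period
(`hasFracLaplacianAt_fourierMode`): for `α ≠ 1` the factor `|sin(s - t)|^(1-α)` is integrated against
the continuous function `sin^α (2 cos + i k sin) e^{ikt}`. The Fourier coefficients of both factors are
integrals `∫₀^π sin^p e^{iqt}`, which satisfy a two-term recursion in `q`. The recursion has two uses:
solving it gives the quotients of Gamma values (`sinExpIntegral_even`, `sinExpIntegral_odd`), and a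
telescoping consequence of it shows that the Fourier series of the second factor converges absolutely
(`summable_mul_norm_sinExpIntegral`). The series may therefore be integrated term by term against the
singular factor (`hasSum_integral_sinDensity_mul`), and the reflection formula collects the constants.

For `α = 1` the weight is `log |sin(s - t)| - log sin t` up to a constant that does not contribute. The
Fourier coefficients of `log sin` are `-π / (2 |l|)` (`mul_logSinExpIntegral`), and
`∫₀^π sin² e^{iqt}` is elementary: for even `k` only three terms of the series survive, and for odd `k`
the contribution of `log sin t` is a telescoping series (`hasSum_sign_div`).
-/

/-! ### Two integrations by parts in the singular integral -/

theorem setOf_lt_abs_eq_union {ε : ℝ} : {y : ℝ | ε < |y|} = Set.Iio (-ε) ∪ Set.Ioi ε := by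
  ext y
  simp only [Set.mem_ofPred_eq, lt_abs, Set.mem_union, Set.mem_Iio, Set.mem_Ioi]
  constructor
  · rintro (h | h)
    · exact Or.inr h
    · exact Or.inl (by linarith)
  · rintro (h | h)
    · exact Or.inr (by linarith)
    · exact Or.inl h

theorem integrableOn_Iio_neg_iff {f : ℝ → ℂ} {ε : ℝ} :
    IntegrableOn f (Set.Iio (-ε)) ↔ IntegrableOn (fun y => f (-y)) (Set.Ioi ε) := by
  have h := (Measure.measurePreserving_neg (volume : Measure ℝ)).integrableOn_comp_preimage
    (Homeomorph.neg ℝ).measurableEmbedding (f := f) (s := Set.Iio (-ε))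
  have h2 : (fun y : ℝ => -y) ⁻¹' Set.Iio (-ε) = Set.Ioi ε := by
    ext y; simp
  rw [← h]
  exact iff_of_eq (congrArg (fun s => IntegrableOn (f ∘ Neg.neg) s volume) h2)

/-- Absolute convergence of the truncated integrals, stated on each of the half lines `y > ε` and
`y < -ε`, the latter reflected. -/
theorem integrableOn_fracIntegrand_Ioi {α ε C : ℝ} (hα : 0 < α) (hε : 0 < ε) {u : ℝ → ℂ}
    (hu : Continuous u) (bu : ∀ z, ‖u z‖ ≤ C) (x : ℝ) :
    IntegrableOn (fun y => fracIntegrand α u x y) (Set.Ioi ε) ∧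
    IntegrableOn (fun y => fracIntegrand α u x (-y)) (Set.Ioi ε) := by
  have key : IntegrableOn (fun y : ℝ => (2 * C) * y ^ (-1 - α)) (Set.Ioi ε) :=
    ((integrableOn_Ioi_rpow_iff hε).2 (by linarith)).const_mul _
  have hm : Measurable (fracIntegrand α u x) := by
    unfold fracIntegrand
    have := hu.measurable
    fun_prop
  have bd : ∀ y : ℝ, ε < |y| → ‖fracIntegrand α u x y‖ ≤ (2 * C) * |y| ^ (-1 - α) := by
    intro y hy
    have hy' : 0 < |y| := hε.trans hy
    have h1 : ‖u x - u (x + y)‖ ≤ 2 * C := by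
      linarith [norm_sub_le (u x) (u (x + y)), bu x, bu (x + y)]
    have h2 : |y| ^ (-1 - α) = (|y| ^ (1 + α))⁻¹ := by
      rw [← Real.rpow_neg hy'.le]; congr 1; ring
    rw [fracIntegrand, norm_div, Complex.norm_real, Real.norm_eq_abs,
      abs_of_pos (Real.rpow_pos_of_pos hy' _), h2, div_eq_mul_inv]
    gcongr
  constructor
  · refine Integrable.mono' key hm.aestronglyMeasurable ?_
    filter_upwards [ae_restrict_mem measurableSet_Ioi] with y hy
    have hy' : 0 < y := hε.trans hy
    simpa [abs_of_pos hy'] using bd y (by rw [abs_of_pos hy']; exact hy)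
  · refine Integrable.mono' key (hm.comp measurable_neg).aestronglyMeasurable ?_
    filter_upwards [ae_restrict_mem measurableSet_Ioi] with y hy
    have hy' : 0 < y := hε.trans hy
    simpa [abs_of_pos hy'] using bd (-y) (by rw [abs_neg, abs_of_pos hy']; exact hy)

/-- Pairing `y` with `-y` replaces the truncated integral by one of a second difference. -/
theorem integral_fracIntegrand_eq_Ioi {α ε C : ℝ} (hα : 0 < α) (hε : 0 < ε) {u : ℝ → ℂ}
    (hu : Continuous u) (bu : ∀ z, ‖u z‖ ≤ C) (x : ℝ) :
    ∫ y in {y : ℝ | ε < |y|}, fracIntegrand α u x y =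
      ∫ y in Set.Ioi ε, (2 * u x - u (x + y) - u (x - y)) * ((y ^ (-1 - α) : ℝ) : ℂ) := by
  obtain ⟨h1, h2⟩ := integrableOn_fracIntegrand_Ioi hα hε hu bu x
  rw [setOf_lt_abs_eq_union, setIntegral_union _ measurableSet_Ioi
    (integrableOn_Iio_neg_iff.2 h2) h1, ← integral_Iic_eq_integral_Iio, ← integral_comp_neg_Ioi,
    ← integral_add h2 h1]
  · refine setIntegral_congr_fun measurableSet_Ioi fun y hy => ?_
    have hy' : 0 < y := hε.trans hy
    have h3 : y ^ (-1 - α) = (y ^ (1 + α))⁻¹ := by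
      rw [← Real.rpow_neg hy'.le]; congr 1; ring
    simp only [fracIntegrand, abs_neg, abs_of_pos hy', h3, ← sub_eq_add_neg]
    push_cast
    ring
  · rw [Set.disjoint_left]
    intro y hy hy2
    simp only [Set.mem_Iio, Set.mem_Ioi] at hy hy2
    linarith

/-- Mean value bounds for the symmetric second difference of `u` and its derivative: they vanish to
second and first order at `0`. -/
theorem norm_second_difference_le {u u' u'' : ℝ → ℂ} {C : ℝ}
    (hu : ∀ z, HasDerivAt u (u' z) z) (hu' : ∀ z, HasDerivAt u' (u'' z) z)
    (bu'' : ∀ z, ‖u'' z‖ ≤ C) (x : ℝ) {y : ℝ} (hy : 0 ≤ y) :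
    ‖u' (x - y) - u' (x + y)‖ ≤ 2 * C * y ∧
      ‖2 * u x - u (x + y) - u (x - y)‖ ≤ 2 * C * y ^ 2 := by
  have hC : 0 ≤ C := (norm_nonneg _).trans (bu'' 0)
  have h1 : ∀ t : ℝ, 0 ≤ t → ‖u' (x - t) - u' (x + t)‖ ≤ 2 * C * t := by
    intro t ht
    have := (convex_univ (𝕜 := ℝ) (E := ℝ)).norm_image_sub_le_of_norm_hasDerivWithin_le
      (f := u') (f' := u'') (C := C) (fun z _ => (hu' z).hasDerivWithinAt) (fun z _ => bu'' z)
      (Set.mem_univ (x + t)) (Set.mem_univ (x - t))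
    refine this.trans (le_of_eq ?_)
    rw [Real.norm_eq_abs, show x - t - (x + t) = -(2 * t) by ring, abs_neg,
      abs_of_nonneg (by linarith)]
    ring
  refine ⟨h1 y hy, ?_⟩
  have hd : ∀ t : ℝ, HasDerivAt (fun t => 2 * u x - u (x + t) - u (x - t))
      (u' (x - t) - u' (x + t)) t := by
    intro t
    have a := (hu (x + t)).comp_const_add x t
    have b := (hu (x - t)).comp_const_sub x t
    exact (((hasDerivAt_const t (2 * u x)).sub a).sub b).congr_deriv (by ring)
  have := (convex_Icc (0 : ℝ) y).norm_image_sub_le_of_norm_hasDerivWithin_le (C := 2 * C * y)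
      (fun z _ => (hd z).hasDerivWithinAt)
      (fun z hz => (h1 z hz.1).trans (by have := hz.2; gcongr))
      (Set.left_mem_Icc.2 hy) (Set.right_mem_Icc.2 hy)
  simp only [add_zero, sub_zero, Real.norm_eq_abs, abs_of_nonneg hy] at this
  rw [show 2 * u x - u x - u x = 0 by ring, sub_zero] at this
  refine this.trans (le_of_eq (by ring))

/-- Two integrations by parts: if `Ψ'' = -y^(-1-α)` on `(0, ∞)`, then the principal value defining
the fractional Laplacian is the convergent integral of `u''` against `Ψ(|z - x|)`. -/
theorem hasFracLaplacianAt_of_kernel {α C : ℝ} (hα : 0 < α) {u u' u'' : ℝ → ℂ} {Ψ ψ : ℝ → ℝ}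
    {x : ℝ} (hu : ∀ z, HasDerivAt u (u' z) z) (hu' : ∀ z, HasDerivAt u' (u'' z) z)
    (bu : ∀ z, ‖u z‖ ≤ C) (bu' : ∀ z, z ^ 2 * ‖u' z‖ ≤ C) (bu'' : ∀ z, ‖u'' z‖ ≤ C)
    (hΨ : ∀ y, 0 < y → HasDerivAt Ψ (ψ y) y)
    (hψ : ∀ y, 0 < y → HasDerivAt ψ (-(y ^ (-1 - α))) y)
    (lψ0 : Tendsto (fun y => y ^ 2 * ψ y) (𝓝[>] 0) (𝓝 0))
    (lΨ0 : Tendsto (fun y => y * Ψ y) (𝓝[>] 0) (𝓝 0))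
    (lψ : Tendsto ψ atTop (𝓝 0)) (lΨ : Tendsto (fun y => Ψ y / y ^ 2) atTop (𝓝 0))
    (hint : Integrable (fun z => u'' z * (Ψ |z - x| : ℂ))) :
    HasFracLaplacianAt α u x (fracConst α * ∫ z, u'' z * (Ψ |z - x| : ℂ)) := by
  have hcu : Continuous u := continuous_iff_continuousAt.2 fun z => (hu z).continuousAt
  have hC : 0 ≤ C := (norm_nonneg _).trans (bu 0)
  refine ⟨fun ε hε => ?_, ?_⟩
  · obtain ⟨h1, h2⟩ := integrableOn_fracIntegrand_Ioi hα hε hcu bu x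
    rw [setOf_lt_abs_eq_union]
    exact (integrableOn_Iio_neg_iff.2 h2).union h1
  refine Tendsto.const_mul _ ?_
  set g : ℝ → ℂ := fun y => 2 * u x - u (x + y) - u (x - y) with hg
  set g' : ℝ → ℂ := fun y => u' (x - y) - u' (x + y) with hg'
  set h : ℝ → ℂ := fun y => (u'' (x + y) + u'' (x - y)) * (Ψ y : ℂ) with hh
  -- `H` is a primitive of the difference of the two integrands that the parts formula compares.
  set H : ℝ → ℂ := fun y => g' y * (Ψ y : ℂ) - g y * (ψ y : ℂ) with hH
  have dg : ∀ t : ℝ, HasDerivAt g (g' t) t := by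
    intro t
    have a := (hu (x + t)).comp_const_add x t
    have b := (hu (x - t)).comp_const_sub x t
    exact (((hasDerivAt_const t (2 * u x)).sub a).sub b).congr_deriv (by simp only [hg']; ring)
  have dg' : ∀ t : ℝ, HasDerivAt g' (-(u'' (x + t) + u'' (x - t))) t := by
    intro t
    have a := (hu' (x + t)).comp_const_add x t
    have b := (hu' (x - t)).comp_const_sub x t
    exact (b.sub a).congr_deriv (by ring)
  have dH : ∀ t, 0 < t → HasDerivAt H (g t * ((t ^ (-1 - α) : ℝ) : ℂ) - h t) t := by
    intro t ht
    have := ((dg' t).mul (hΨ t ht).ofReal_comp).sub ((dg t).mul (hψ t ht).ofReal_comp)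
    refine this.congr_deriv ?_
    simp only [hh]
    push_cast
    ring
  -- The symmetrized integrand `h` is integrable on the half line.
  have ih1 : Integrable (fun y => u'' (x + y) * (Ψ |y| : ℂ)) := by
    have := hint.comp_add_left x
    simpa using this
  have ih2 : Integrable (fun y => u'' (x - y) * (Ψ |y| : ℂ)) := by
    have := hint.comp_sub_left x
    simpa using this
  have ihI : IntegrableOn h (Set.Ioi 0) := by
    refine (ih1.add ih2).integrableOn.congr_fun (fun y hy => ?_) measurableSet_Ioi
    simp only [hh, Pi.add_apply, abs_of_pos (Set.mem_Ioi.1 hy)]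
    ring
  have eq_h : ∫ y in Set.Ioi (0 : ℝ), h y = ∫ z, u'' z * (Ψ |z - x| : ℂ) := by
    have e1 : ∫ z, u'' z * (Ψ |z - x| : ℂ) = ∫ y, u'' (x + y) * (Ψ |y| : ℂ) := by
      rw [← integral_add_left_eq_self (fun z => u'' z * (Ψ |z - x| : ℂ)) x]
      simp
    rw [e1, ← integral_add_compl (measurableSet_Ioi (a := (0:ℝ))) ih1, Set.compl_Ioi]
    have e2 := integral_comp_neg_Ioi 0 (fun y => u'' (x + y) * (Ψ |y| : ℂ))
    rw [neg_zero] at e2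
    rw [← e2, ← integral_add ih1.integrableOn]
    · refine setIntegral_congr_fun measurableSet_Ioi fun y hy => ?_
      simp only [hh, abs_neg, abs_of_pos (Set.mem_Ioi.1 hy), ← sub_eq_add_neg]
      ring
    · simp only [abs_neg, ← sub_eq_add_neg]
      exact ih2.integrableOn
  -- At `0` the second difference and its derivative are `O(y²)` and `O(y)`; at `∞` they are `O(1)`
  -- and `O(y⁻²)`.
  have H0 : Tendsto H (𝓝[>] 0) (𝓝 0) := by
    have b : Tendsto (fun y => 2 * C * |y * Ψ y| + 2 * C * |y ^ 2 * ψ y|) (𝓝[>] 0) (𝓝 0) := by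
      have := (lΨ0.abs.const_mul (2 * C)).add (lψ0.abs.const_mul (2 * C))
      simpa using this
    refine squeeze_zero_norm' ?_ b
    filter_upwards [self_mem_nhdsWithin] with y hy
    have hy' : (0 : ℝ) < y := hy
    obtain ⟨b1, b2⟩ := norm_second_difference_le hu hu' bu'' x hy'.le
    calc ‖H y‖ ≤ ‖g' y‖ * |Ψ y| + ‖g y‖ * |ψ y| := by
          refine (norm_sub_le _ _).trans ?_
          simp
      _ ≤ (2 * C * y) * |Ψ y| + (2 * C * y ^ 2) * |ψ y| := by gcongr
      _ = _ := by
          rw [abs_mul, abs_mul, abs_of_pos hy', abs_of_pos (pow_pos hy' 2)]; ring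
  have Hinf : Tendsto H atTop (𝓝 0) := by
    have b : Tendsto (fun y => 8 * C * |Ψ y / y ^ 2| + 4 * C * |ψ y|) atTop (𝓝 0) := by
      have := (lΨ.abs.const_mul (8 * C)).add (lψ.abs.const_mul (4 * C))
      simpa using this
    refine squeeze_zero_norm' ?_ b
    filter_upwards [eventually_gt_atTop 0, eventually_ge_atTop (2 * |x|)] with y hy hyx
    have far : ∀ z : ℝ, y / 2 ≤ |z| → ‖u' z‖ ≤ 4 * C / y ^ 2 := by
      intro z hz
      rw [le_div_iff₀ (pow_pos hy 2)]
      have : (y / 2) ^ 2 ≤ z ^ 2 := by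
        rw [← sq_abs z]; gcongr
      nlinarith [bu' z, norm_nonneg (u' z)]
    have b1 : ‖g' y‖ ≤ 8 * C / y ^ 2 := by
      have p1 := far (x - y) (by
        have := neg_abs_le (x - y); have := le_abs_self x; linarith)
      have p2 := far (x + y) (by
        have := le_abs_self (x + y); have := neg_abs_le x; linarith)
      calc ‖g' y‖ ≤ _ := norm_sub_le _ _
        _ ≤ 4 * C / y ^ 2 + 4 * C / y ^ 2 := add_le_add p1 p2
        _ = _ := by ring
    have b2 : ‖g y‖ ≤ 4 * C := by
      have t1 := norm_sub_le (2 * u x - u (x + y)) (u (x - y))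
      have t2 := norm_sub_le (2 * u x) (u (x + y))
      have t3 : ‖2 * u x‖ = 2 * ‖u x‖ := by simp
      simp only [hg]
      linarith [bu x, bu (x + y), bu (x - y)]
    calc ‖H y‖ ≤ ‖g' y‖ * |Ψ y| + ‖g y‖ * |ψ y| := by
          refine (norm_sub_le _ _).trans ?_
          simp
      _ ≤ (8 * C / y ^ 2) * |Ψ y| + (4 * C) * |ψ y| := by gcongr
      _ = _ := by
          rw [abs_div, abs_of_pos (pow_pos hy 2)]; ring
  have main : ∀ ε : ℝ, 0 < ε →
      ∫ y in {y : ℝ | ε < |y|}, fracIntegrand α u x y = (∫ y in Set.Ioi ε, h y) - H ε := by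
    intro ε hε
    rw [integral_fracIntegrand_eq_Ioi hα hε hcu bu x]
    have i1 : IntegrableOn (fun y => g y * ((y ^ (-1 - α) : ℝ) : ℂ)) (Set.Ioi ε) := by
      obtain ⟨h1, h2⟩ := integrableOn_fracIntegrand_Ioi hα hε hcu bu x
      refine (h1.add h2).congr_fun (fun y hy => ?_) measurableSet_Ioi
      have hy' : 0 < y := hε.trans hy
      have h3 : y ^ (-1 - α) = (y ^ (1 + α))⁻¹ := by
        rw [← Real.rpow_neg hy'.le]; congr 1; ring
      simp only [Pi.add_apply, fracIntegrand, abs_neg, abs_of_pos hy', h3, ← sub_eq_add_neg, hg]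
      push_cast
      ring
    have i2 : IntegrableOn h (Set.Ioi ε) := ihI.mono_set (Set.Ioi_subset_Ioi hε.le)
    have := integral_Ioi_of_hasDerivAt_of_tendsto (f := H) (a := ε) (m := 0)
      (dH ε hε).continuousAt.continuousWithinAt (fun t ht => dH t (hε.trans ht)) (i1.sub i2) Hinf
    rw [integral_sub i1 i2] at this
    linear_combination this
  have lim : Tendsto (fun ε => ∫ y in Set.Ioi ε, h y) (𝓝[>] 0) (𝓝 (∫ y in Set.Ioi (0:ℝ), h y)) := by
    have hc : ContinuousWithinAt (fun ε => ∫ y in Set.Ioi ε, h y) (Set.Ioi 0) 0 := by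
      have ha : AECover (volume.restrict (Set.Ioi (0:ℝ))) (𝓝[>] (0:ℝ)) (fun ε => Set.Ioi ε) :=
        aecover_Ioi_of_Ioi (tendsto_id.mono_left nhdsWithin_le_nhds)
      have := ha.integral_tendsto_of_countably_generated ihI
      refine Tendsto.congr' ?_ this
      filter_upwards [self_mem_nhdsWithin] with ε hε
      rw [Measure.restrict_restrict measurableSet_Ioi,
        Set.inter_eq_left.2 (Set.Ioi_subset_Ioi (le_of_lt hε))]
    exact hc
  rw [← eq_h, ← sub_zero (∫ y in Set.Ioi (0 : ℝ), h y)]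
  refine (lim.sub H0).congr' ?_
  filter_upwards [self_mem_nhdsWithin] with ε hε
  exact (main ε hε).symm

/-! ### The integrals of `sin^p e^{iqt}` over `(0, π)` -/

/-- The integral `∫₀^π sin(t)^p e^{iqt} dt`, which converges absolutely for `p > -1`. -/
noncomputable def sinExpIntegral (p : ℝ) (q : ℤ) : ℂ :=
  ∫ t in (0 : ℝ)..Real.pi, ((Real.sin t ^ p : ℝ) : ℂ) * Complex.exp (Complex.I * q * t)

theorem norm_exp_I_mul_int_mul (q : ℤ) (t : ℝ) : ‖Complex.exp (Complex.I * q * t)‖ = 1 := by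
  have := Complex.norm_exp_ofReal_mul_I ((q : ℝ) * t)
  rw [← this]
  congr 2
  push_cast
  ring

theorem continuous_exp_I_mul_int_mul (q : ℤ) :
    Continuous fun t : ℝ => Complex.exp (Complex.I * q * t) := by fun_prop

theorem hasDerivAt_exp_I_mul_int_mul (q : ℤ) (t : ℝ) :
    HasDerivAt (fun t : ℝ => Complex.exp (Complex.I * q * t))
      (Complex.I * q * Complex.exp (Complex.I * q * t)) t := by
  have h : HasDerivAt (fun t : ℝ => Complex.I * (q : ℂ) * (t : ℂ)) (Complex.I * q) t := by
    simpa using (Complex.ofRealCLM.hasDerivAt (x := t)).const_mul (Complex.I * (q : ℂ))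
  exact h.cexp.congr_deriv (by ring)

/-- The substitution `x = (1 - cos t) / 2`, for which `x (1 - x) = (sin t / 2) ^ 2`, turns the
beta integral `B((p+1)/2, (p+1)/2)` into `∫₀^π sin^p`. -/
theorem integrableOn_sin_rpow_and_integral {p : ℝ} (hp : -1 < p) :
    IntegrableOn (fun t => Real.sin t ^ p) (Set.Ioo 0 Real.pi) ∧
      ∫ t in Set.Ioo 0 Real.pi, Real.sin t ^ p =
        2 ^ p * (Real.Gamma ((p + 1) / 2) ^ 2 / Real.Gamma (p + 1)) := by
  have ha : 0 < (p + 1) / 2 := by linarith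
  set φ : ℝ → ℝ := fun t => (1 - Real.cos t) / 2 with hφ
  have hd : ∀ t ∈ Set.Ioo 0 Real.pi, HasDerivWithinAt φ (Real.sin t / 2) (Set.Ioo 0 Real.pi) t := by
    intro t _
    have := ((Real.hasDerivAt_cos t).const_sub 1).div_const 2
    exact (this.congr_deriv (by ring)).hasDerivWithinAt
  have hinj : Set.InjOn φ (Set.Ioo 0 Real.pi) := by
    intro a ha b hb hab
    simp only [hφ] at hab
    exact Real.injOn_cos ⟨ha.1.le, ha.2.le⟩ ⟨hb.1.le, hb.2.le⟩ (by linarith)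
  have himg : φ '' Set.Ioo 0 Real.pi = Set.Ioo 0 1 := by
    ext x
    constructor
    · rintro ⟨t, ht, rfl⟩
      have hs := Real.sin_pos_of_mem_Ioo ht
      have h1 := Real.sin_sq_add_cos_sq t
      have : 0 < Real.sin t ^ 2 := by positivity
      simp only [hφ]
      constructor <;> nlinarith [Real.cos_le_one t, Real.neg_one_le_cos t]
    · intro hx
      refine ⟨Real.arccos (1 - 2 * x), ⟨Real.arccos_pos.2 (by linarith [hx.1]), ?_⟩, ?_⟩
      · refine lt_of_le_of_ne (Real.arccos_le_pi _) ?_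
        rw [Ne, Real.arccos_eq_pi]
        linarith [hx.2]
      · simp only [hφ]
        rw [Real.cos_arccos (by linarith [hx.2]) (by linarith [hx.1])]
        ring
  set f : ℝ → ℂ := fun x => (x : ℂ) ^ ((((p + 1) / 2 : ℝ) : ℂ) - 1) *
    (1 - (x : ℂ)) ^ ((((p + 1) / 2 : ℝ) : ℂ) - 1) with hf
  have hfe : ∀ t ∈ Set.Ioo 0 Real.pi,
      |Real.sin t / 2| • f (φ t) = ((2 ^ (-p) * Real.sin t ^ p : ℝ) : ℂ) := by
    intro t ht
    have hs := Real.sin_pos_of_mem_Ioo ht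
    have hx : φ t ∈ Set.Ioo (0 : ℝ) 1 := himg ▸ Set.mem_image_of_mem φ ht
    have e1 : f (φ t) = ((φ t ^ ((p + 1) / 2 - 1) * (1 - φ t) ^ ((p + 1) / 2 - 1) : ℝ) : ℂ) := by
      simp only [hf]
      rw [Complex.ofReal_mul, Complex.ofReal_cpow hx.1.le,
        Complex.ofReal_cpow (by linarith [hx.2])]
      push_cast
      ring_nf
    have e2 : φ t ^ ((p + 1) / 2 - 1) * (1 - φ t) ^ ((p + 1) / 2 - 1) =
        (Real.sin t / 2) ^ (p - 1) := by
      rw [← Real.mul_rpow hx.1.le (by linarith [hx.2])]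
      have : φ t * (1 - φ t) = (Real.sin t / 2) ^ (2 : ℝ) := by
        rw [Real.rpow_two]
        simp only [hφ]
        nlinarith [Real.sin_sq_add_cos_sq t]
      rw [this, ← Real.rpow_mul (by positivity)]
      congr 1
      ring
    rw [e1, e2, Complex.real_smul, ← Complex.ofReal_mul, abs_of_pos (by positivity)]
    congr 1
    rw [show Real.sin t / 2 * (Real.sin t / 2) ^ (p - 1) = (Real.sin t / 2) ^ p by
      rw [Real.rpow_sub_one (by positivity)]
      field_simp,
      Real.div_rpow hs.le (by norm_num), Real.rpow_neg (by norm_num)]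
    field_simp
  have hre : 0 < (((p + 1) / 2 : ℝ) : ℂ).re := by simpa using ha
  have hconv := Complex.betaIntegral_convergent hre hre
  have h1 : IntegrableOn f (Set.Ioo 0 1) := by
    rw [intervalIntegrable_iff_integrableOn_Ioo_of_le zero_le_one] at hconv
    exact hconv
  have hint : IntegrableOn (fun t => ((2 ^ (-p) * Real.sin t ^ p : ℝ) : ℂ)) (Set.Ioo 0 Real.pi) := by
    rw [← himg, integrableOn_image_iff_integrableOn_abs_deriv_smul measurableSet_Ioo hd hinj] at h1
    exact h1.congr_fun hfe measurableSet_Ioo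
  have hval : ∫ x in Set.Ioo (0 : ℝ) 1, f x =
      ((2 ^ (-p) * ∫ t in Set.Ioo 0 Real.pi, Real.sin t ^ p : ℝ) : ℂ) := by
    rw [← himg, integral_image_eq_integral_abs_deriv_smul measurableSet_Ioo hd hinj,
      setIntegral_congr_fun measurableSet_Ioo hfe, integral_complex_ofReal, integral_const_mul]
  have hB : ∫ x in Set.Ioo (0 : ℝ) 1, f x =
      ((Real.Gamma ((p + 1) / 2) ^ 2 / Real.Gamma (p + 1) : ℝ) : ℂ) := by
    have hb := Complex.betaIntegral_eq_Gamma_mul_div _ _ hre hre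
    rw [Complex.betaIntegral, intervalIntegral.integral_of_le zero_le_one,
      integral_Ioc_eq_integral_Ioo] at hb
    rw [hf, hb, Complex.Gamma_ofReal, ← Complex.ofReal_add, Complex.Gamma_ofReal]
    push_cast
    rw [show (p + 1) / 2 + (p + 1) / 2 = p + 1 by ring]
    ring
  have hfin := hval.symm.trans hB
  have h2p : (2 : ℝ) ^ (-p) * 2 ^ p = 1 := by
    rw [← Real.rpow_add (by norm_num)]; simp
  constructor
  · have h3 : IntegrableOn (fun t => (2 : ℝ) ^ p * RCLike.re ((2 ^ (-p) * Real.sin t ^ p : ℝ) : ℂ))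
        (Set.Ioo 0 Real.pi) := (hint.re).const_mul (2 ^ p)
    refine h3.congr_fun (fun t _ => ?_) measurableSet_Ioo
    simp only [RCLike.re_to_complex, Complex.ofReal_re]
    rw [← mul_assoc, mul_comm ((2 : ℝ) ^ p), h2p, one_mul]
  · rw [← Complex.ofReal_inj.1 hfin, ← mul_assoc, mul_comm ((2 : ℝ) ^ p), h2p, one_mul]

theorem intervalIntegrable_sin_rpow {p : ℝ} (hp : -1 < p) :
    IntervalIntegrable (fun t => Real.sin t ^ p) volume 0 Real.pi := by
  rw [intervalIntegrable_iff_integrableOn_Ioo_of_le Real.pi_pos.le]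
  exact (integrableOn_sin_rpow_and_integral hp).1

theorem intervalIntegrable_sin_rpow_mul {p : ℝ} (hp : -1 < p) {f : ℝ → ℂ} (hf : Continuous f) :
    IntervalIntegrable (fun t => ((Real.sin t ^ p : ℝ) : ℂ) * f t) volume 0 Real.pi := by
  have h1 : IntervalIntegrable (fun t => ((Real.sin t ^ p : ℝ) : ℂ)) volume 0 Real.pi :=
    ⟨(intervalIntegrable_sin_rpow hp).1.ofReal, (intervalIntegrable_sin_rpow hp).2.ofReal⟩
  exact h1.mul_continuousOn hf.continuousOn

theorem sinExpIntegral_zero {p : ℝ} (hp : -1 < p) :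
    sinExpIntegral p 0 =
      ((√Real.pi * Real.Gamma ((p + 1) / 2) / Real.Gamma (p / 2 + 1) : ℝ) : ℂ) := by
  have h1 : sinExpIntegral p 0 = ((∫ t in Set.Ioo 0 Real.pi, Real.sin t ^ p : ℝ) : ℂ) := by
    rw [sinExpIntegral, intervalIntegral.integral_of_le Real.pi_pos.le,
      integral_Ioc_eq_integral_Ioo, ← integral_complex_ofReal]
    simp
  rw [h1, (integrableOn_sin_rpow_and_integral hp).2]
  congr 1
  have hdup := Real.Gamma_mul_Gamma_add_half ((p + 1) / 2)
  rw [show (p + 1) / 2 + 1 / 2 = (p + 2) / 2 by ring, show 2 * ((p + 1) / 2) = p + 1 by ring,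
    show 1 - (p + 1) = -p by ring, Real.rpow_neg (by norm_num)] at hdup
  have g1 := Real.Gamma_pos_of_pos (show 0 < (p + 1) / 2 by linarith)
  have g2 := Real.Gamma_pos_of_pos (show 0 < (p + 2) / 2 by linarith)
  have g3 := Real.Gamma_pos_of_pos (show 0 < p + 1 by linarith)
  have h2 : (0:ℝ) < 2 ^ p := by positivity
  rw [show p / 2 + 1 = (p + 2) / 2 by ring]
  field_simp at hdup ⊢
  linear_combination hdup

theorem sin_rpow_add_one {p t : ℝ} (ht : t ∈ Set.Ioo 0 Real.pi) :
    Real.sin t ^ (p + 1) = Real.sin t ^ p * Real.sin t :=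
  Real.rpow_add_one (Real.sin_pos_of_mem_Ioo ht).ne' p

theorem hasDerivAt_sin_rpow_add_one {p t : ℝ} (ht : t ∈ Set.Ioo 0 Real.pi) :
    HasDerivAt (fun t => Real.sin t ^ (p + 1)) ((p + 1) * Real.sin t ^ p * Real.cos t) t := by
  have := (Real.hasDerivAt_sin t).rpow_const (p := p + 1)
    (Or.inl (Real.sin_pos_of_mem_Ioo ht).ne')
  exact this.congr_deriv (by rw [add_sub_cancel_right]; ring)

/-- `sin^(p+1) e^{iqt}` vanishes at `0` and `π`, so the integral of its derivative is zero. -/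
theorem integral_sin_rpow_mul_cos_add_sin {p : ℝ} (hp : -1 < p) (q : ℤ) :
    ∫ t in (0 : ℝ)..Real.pi, ((Real.sin t ^ p : ℝ) : ℂ) * (((p + 1) * Real.cos t : ℂ) +
      Complex.I * q * Real.sin t) * Complex.exp (Complex.I * q * t) = 0 := by
  have h := intervalIntegral.integral_eq_sub_of_hasDerivAt_of_le (a := 0) (b := Real.pi)
    (f := fun t => ((Real.sin t ^ (p + 1) : ℝ) : ℂ) * Complex.exp (Complex.I * q * t))
    (f' := fun t => ((Real.sin t ^ p : ℝ) : ℂ) * (((p + 1) * Real.cos t : ℂ) +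
      Complex.I * q * Real.sin t) * Complex.exp (Complex.I * q * t)) Real.pi_pos.le ?_ ?_ ?_
  · rw [h]
    simp [Real.zero_rpow (show p + 1 ≠ 0 by linarith)]
  · refine Continuous.continuousOn ?_
    have : Continuous fun t => Real.sin t ^ (p + 1) :=
      Real.continuous_sin.rpow_const fun _ => Or.inr (by linarith)
    fun_prop
  · intro t ht
    have := (hasDerivAt_sin_rpow_add_one (p := p) ht).ofReal_comp.mul
      (hasDerivAt_exp_I_mul_int_mul q t)
    refine this.congr_deriv ?_
    rw [sin_rpow_add_one ht]
    push_cast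
    ring
  · simp only [mul_assoc]
    exact intervalIntegrable_sin_rpow_mul hp (by fun_prop)

theorem exp_add_exp_two (q : ℤ) (t : ℝ) :
    Complex.exp (Complex.I * ((q + 2 : ℤ) : ℂ) * t) + Complex.exp (Complex.I * q * t) =
      2 * Complex.cos t * Complex.exp (Complex.I * ((q + 1 : ℤ) : ℂ) * t) := by
  rw [Complex.cos]
  have h1 : Complex.I * ((q + 2 : ℤ) : ℂ) * t = Complex.I * ((q + 1 : ℤ) : ℂ) * t + t * Complex.I := by
    push_cast; ring
  have h2 : Complex.I * (q : ℂ) * t = Complex.I * ((q + 1 : ℤ) : ℂ) * t + -t * Complex.I := by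
    push_cast; ring
  rw [h1, h2, Complex.exp_add, Complex.exp_add]
  ring

theorem exp_sub_exp_two (q : ℤ) (t : ℝ) :
    Complex.exp (Complex.I * ((q + 2 : ℤ) : ℂ) * t) - Complex.exp (Complex.I * q * t) =
      2 * Complex.I * Complex.sin t * Complex.exp (Complex.I * ((q + 1 : ℤ) : ℂ) * t) := by
  rw [Complex.sin]
  have h1 : Complex.I * ((q + 2 : ℤ) : ℂ) * t = Complex.I * ((q + 1 : ℤ) : ℂ) * t + t * Complex.I := by
    push_cast; ring
  have h2 : Complex.I * (q : ℂ) * t = Complex.I * ((q + 1 : ℤ) : ℂ) * t + -t * Complex.I := by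
    push_cast; ring
  rw [h1, h2, Complex.exp_add, Complex.exp_add]
  linear_combination (Complex.exp (t * Complex.I) - Complex.exp (-t * Complex.I)) *
    Complex.exp (Complex.I * ((q + 1 : ℤ) : ℂ) * t) * Complex.I_sq

/-- The recursion in `q`, obtained by writing `cos` and `sin` as exponentials in
`integral_sin_rpow_mul_cos_add_sin`. -/
theorem sinExpIntegral_add_two {p : ℝ} (hp : -1 < p) (q : ℤ) :
    ((p + 2 + q : ℝ) : ℂ) * sinExpIntegral p (q + 2) =
      ((q - p : ℝ) : ℂ) * sinExpIntegral p q := by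
  have h := integral_sin_rpow_mul_cos_add_sin hp (q + 1)
  have e : ∀ t : ℝ, ((Real.sin t ^ p : ℝ) : ℂ) * (((p + 1) * Real.cos t : ℂ) +
      Complex.I * ((q + 1 : ℤ) : ℂ) * Real.sin t) * Complex.exp (Complex.I * ((q + 1 : ℤ) : ℂ) * t) =
      ((p + 2 + q) / 2 : ℂ) *
        (((Real.sin t ^ p : ℝ) : ℂ) * Complex.exp (Complex.I * ((q + 2 : ℤ) : ℂ) * t)) -
      ((q - p) / 2 : ℂ) * (((Real.sin t ^ p : ℝ) : ℂ) * Complex.exp (Complex.I * q * t)) := by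
    intro t
    have h1 := exp_add_exp_two q t
    have h2 := exp_sub_exp_two q t
    push_cast at h1 h2 ⊢
    linear_combination -(((Real.sin t ^ p : ℝ) : ℂ) * ((p + 1) / 2)) * h1 -
      (((Real.sin t ^ p : ℝ) : ℂ) * ((q + 1) / 2)) * h2
  simp only [e] at h
  rw [intervalIntegral.integral_sub, intervalIntegral.integral_const_mul,
    intervalIntegral.integral_const_mul, ← sinExpIntegral, ← sinExpIntegral] at h
  · push_cast
    linear_combination 2 * h
  · exact (intervalIntegrable_sin_rpow_mul hp (continuous_exp_I_mul_int_mul _)).const_mul _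
  · exact (intervalIntegrable_sin_rpow_mul hp (continuous_exp_I_mul_int_mul _)).const_mul _

theorem sinExpIntegral_neg (p : ℝ) (q : ℤ) :
    sinExpIntegral p (-q) = (starRingEnd ℂ) (sinExpIntegral p q) := by
  rw [sinExpIntegral, sinExpIntegral, intervalIntegral.integral_of_le Real.pi_pos.le,
    intervalIntegral.integral_of_le Real.pi_pos.le, ← integral_conj]
  congr 1
  ext t
  rw [map_mul, Complex.conj_ofReal, ← Complex.exp_conj]
  congr 2
  simp

theorem sinExpIntegral_one {p : ℝ} (hp : -1 < p) :
    sinExpIntegral p 1 = Complex.I * sinExpIntegral (p + 1) 0 := by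
  have h := integral_sin_rpow_mul_cos_add_sin hp 0
  simp only [Int.cast_zero, mul_zero, zero_mul, add_zero, Complex.exp_zero, mul_one] at h
  have hc : (p : ℂ) + 1 ≠ 0 := by
    exact_mod_cast (show p + 1 ≠ 0 by linarith)
  have h0 : ∫ t in (0 : ℝ)..Real.pi, ((Real.sin t ^ p : ℝ) : ℂ) * Real.cos t = 0 := by
    have e : ∀ t : ℝ, ((Real.sin t ^ p : ℝ) : ℂ) * (((p : ℂ) + 1) * Real.cos t) =
        ((p : ℂ) + 1) * (((Real.sin t ^ p : ℝ) : ℂ) * Real.cos t) := fun t => by ring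
    simp only [e, intervalIntegral.integral_const_mul] at h
    exact (mul_eq_zero.1 h).resolve_left hc
  have e1 : sinExpIntegral p 1 = ∫ t in (0 : ℝ)..Real.pi, (((Real.sin t ^ p : ℝ) : ℂ) * Real.cos t +
      Complex.I * (((Real.sin t ^ p : ℝ) : ℂ) * Real.sin t)) := by
    rw [sinExpIntegral]
    congr 1
    ext t
    rw [Int.cast_one, mul_one, mul_comm Complex.I, Complex.exp_mul_I]
    push_cast
    ring
  rw [e1, intervalIntegral.integral_add, h0, zero_add, intervalIntegral.integral_const_mul]
  · congr 1
    rw [sinExpIntegral, intervalIntegral.integral_of_le Real.pi_pos.le,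
      intervalIntegral.integral_of_le Real.pi_pos.le, integral_Ioc_eq_integral_Ioo,
      integral_Ioc_eq_integral_Ioo]
    refine setIntegral_congr_fun measurableSet_Ioo fun t ht => ?_
    simp only [sin_rpow_add_one ht]
    simp
  · exact intervalIntegrable_sin_rpow_mul hp (by fun_prop)
  · exact (intervalIntegrable_sin_rpow_mul hp (by fun_prop)).const_mul _

/-! ### Gamma quotients, summability and the Fourier series of the density -/

/-- Iterating the recursion in `q` expresses `sinExpIntegral p (r + 2 j)` through
`sinExpIntegral p r`; the quotients of consecutive values are quotients of Gamma values. -/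
theorem sinExpIntegral_add_two_mul {p : ℝ} (hp : -1 < p) {r : ℤ} (hr : 0 ≤ r)
    (hpr : ∀ j : ℕ, (j : ℝ) + (r - p) / 2 ≠ 0) (j : ℕ) :
    sinExpIntegral p (r + 2 * j) * ((Real.Gamma ((r - p) / 2) : ℝ) : ℂ) *
        ((Real.Gamma (j + ((r + p) / 2 + 1)) : ℝ) : ℂ) =
      sinExpIntegral p r * ((Real.Gamma (j + (r - p) / 2) : ℝ) : ℂ) *
        ((Real.Gamma ((r + p) / 2 + 1) : ℝ) : ℂ) := by
  induction j with
  | zero => simp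
  | succ j ih =>
    have hr' : (0 : ℝ) ≤ r := by exact_mod_cast hr
    have hpos : 0 < (j : ℝ) + ((r + p) / 2 + 1) := by
      have : (0 : ℝ) ≤ j := j.cast_nonneg
      linarith
    have h := sinExpIntegral_add_two hp (r + 2 * j)
    have e : r + 2 * ((j + 1 : ℕ) : ℤ) = r + 2 * j + 2 := by push_cast; ring
    rw [e]
    have g1 : Real.Gamma (((j + 1 : ℕ) : ℝ) + ((r + p) / 2 + 1)) =
        (j + ((r + p) / 2 + 1)) * Real.Gamma (j + ((r + p) / 2 + 1)) := by
      rw [← Real.Gamma_add_one hpos.ne']; congr 1; push_cast; ring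
    have g2 : Real.Gamma (((j + 1 : ℕ) : ℝ) + (r - p) / 2) =
        (j + (r - p) / 2) * Real.Gamma (j + (r - p) / 2) := by
      rw [← Real.Gamma_add_one (hpr j)]; congr 1; push_cast; ring
    rw [g1, g2]
    push_cast at h ih ⊢
    linear_combination (Complex.ofReal (Real.Gamma ((r - p) / 2))) *
      (Complex.ofReal (Real.Gamma (j + ((r + p) / 2 + 1)))) / 2 * h +
      (j + (r - p) / 2) * ih

/-- The excluded exponents `p = 2j` are those for which `Γ(-p/2)` is a pole. -/
theorem sinExpIntegral_even {p : ℝ} (hp : -1 < p) (hp2 : ∀ j : ℕ, (2 * j : ℝ) ≠ p) (m : ℤ) :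
    sinExpIntegral p (2 * m) = ((√Real.pi * Real.Gamma ((p + 1) / 2) / Real.Gamma (-p / 2) *
      (Real.Gamma (-p / 2 + |(m : ℝ)|) / Real.Gamma (p / 2 + 1 + |(m : ℝ)|)) : ℝ) : ℂ) := by
  have key : ∀ j : ℕ, sinExpIntegral p (2 * (j : ℤ)) =
      ((√Real.pi * Real.Gamma ((p + 1) / 2) / Real.Gamma (-p / 2) *
      (Real.Gamma (-p / 2 + j) / Real.Gamma (p / 2 + 1 + j)) : ℝ) : ℂ) := by
    intro j
    have hne : ∀ i : ℕ, (i : ℝ) + (((0 : ℤ) : ℝ) - p) / 2 ≠ 0 := by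
      intro i hi
      apply hp2 i
      push_cast at hi
      linarith
    have h := sinExpIntegral_add_two_mul hp le_rfl hne j
    simp only [Int.cast_zero, zero_add, zero_sub] at h
    have hΓ0 : Real.Gamma (-p / 2) ≠ 0 := by
      refine Real.Gamma_ne_zero fun i hi => hp2 i (by linarith)
    have hΓ1 : Real.Gamma (p / 2 + 1) ≠ 0 := (Real.Gamma_pos_of_pos (by linarith)).ne'
    have hΓ2 : Real.Gamma (j + (p / 2 + 1)) ≠ 0 :=
      (Real.Gamma_pos_of_pos (by have : (0 : ℝ) ≤ j := j.cast_nonneg; linarith)).ne'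
    rw [sinExpIntegral_zero hp] at h
    rw [show p / 2 + 1 + (j : ℝ) = j + (p / 2 + 1) by ring, show -p / 2 + (j : ℝ) = j + -p / 2 by ring]
    have hΓ0' := Complex.ofReal_ne_zero.2 hΓ0
    have hΓ1' := Complex.ofReal_ne_zero.2 hΓ1
    have hΓ2' := Complex.ofReal_ne_zero.2 hΓ2
    rw [mul_assoc] at h
    rw [eq_div_of_mul_eq (mul_ne_zero hΓ0' hΓ2') h]
    simp only [Complex.ofReal_mul, Complex.ofReal_div]
    generalize Real.Gamma (p / 2 + 1) = x at *
    generalize Real.Gamma (-p / 2) = y at *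
    generalize Real.Gamma (j + (p / 2 + 1)) = z at *
    field_simp
  obtain ⟨j, rfl | rfl⟩ := m.eq_nat_or_neg
  · rw [key]; simp
  · rw [show 2 * -(j : ℤ) = -(2 * j) by ring, sinExpIntegral_neg, key, Complex.conj_ofReal]
    simp

/-- At odd frequencies the coefficient is imaginary; the sign appears because `q ↦ -q` conjugates
it. -/
theorem sinExpIntegral_odd {p : ℝ} (hp : -1 < p) (hp2 : ∀ j : ℕ, (2 * j + 1 : ℝ) ≠ p) (m : ℤ) :
    sinExpIntegral p (2 * m + 1) = Complex.I * (Real.sign ((m : ℝ) + 1 / 2) : ℂ) *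
      ((√Real.pi * Real.Gamma (p / 2 + 1) / Real.Gamma ((1 - p) / 2) *
      (Real.Gamma (-p / 2 + |(m : ℝ) + 1 / 2|) /
        Real.Gamma (p / 2 + 1 + |(m : ℝ) + 1 / 2|)) : ℝ) : ℂ) := by
  have key : ∀ j : ℕ, sinExpIntegral p (2 * (j : ℤ) + 1) = Complex.I *
      ((√Real.pi * Real.Gamma (p / 2 + 1) / Real.Gamma ((1 - p) / 2) *
      (Real.Gamma (-p / 2 + (j + 1 / 2)) / Real.Gamma (p / 2 + 1 + (j + 1 / 2))) : ℝ) : ℂ) := by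
    intro j
    have hne : ∀ i : ℕ, (i : ℝ) + (((1 : ℤ) : ℝ) - p) / 2 ≠ 0 := by
      intro i hi
      apply hp2 i
      push_cast at hi
      linarith
    have h := sinExpIntegral_add_two_mul hp zero_le_one hne j
    simp only [Int.cast_one] at h
    have hΓ0 : Real.Gamma ((1 - p) / 2) ≠ 0 := by
      refine Real.Gamma_ne_zero fun i hi => hp2 i (by linarith)
    have hΓ1 : Real.Gamma ((1 + p) / 2 + 1) ≠ 0 := (Real.Gamma_pos_of_pos (by linarith)).ne'
    have hΓ2 : Real.Gamma (j + ((1 + p) / 2 + 1)) ≠ 0 :=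
      (Real.Gamma_pos_of_pos (by have : (0 : ℝ) ≤ j := j.cast_nonneg; linarith)).ne'
    rw [sinExpIntegral_one hp, sinExpIntegral_zero (by linarith)] at h
    rw [show p / 2 + 1 + ((j : ℝ) + 1 / 2) = j + ((1 + p) / 2 + 1) by ring,
      show -p / 2 + ((j : ℝ) + 1 / 2) = j + (1 - p) / 2 by ring,
      show p / 2 + 1 = (p + 1 + 1) / 2 by ring]
    rw [show (p + 1) / 2 + 1 = (1 + p) / 2 + 1 by ring] at h
    have hΓ0' := Complex.ofReal_ne_zero.2 hΓ0
    have hΓ1' := Complex.ofReal_ne_zero.2 hΓ1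
    have hΓ2' := Complex.ofReal_ne_zero.2 hΓ2
    rw [add_comm 1 (2 * (j : ℤ))] at h
    rw [mul_assoc] at h
    rw [eq_div_of_mul_eq (mul_ne_zero hΓ0' hΓ2') h]
    simp only [Complex.ofReal_mul, Complex.ofReal_div]
    generalize Real.Gamma ((1 + p) / 2 + 1) = x at *
    generalize Real.Gamma ((1 - p) / 2) = y at *
    generalize Real.Gamma (j + ((1 + p) / 2 + 1)) = z at *
    field_simp
  rcases le_or_gt 0 m with hm | hm
  · obtain ⟨j, rfl⟩ := Int.eq_ofNat_of_zero_le hm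
    have hj : (0 : ℝ) < ((j : ℤ) : ℝ) + 1 / 2 := by
      have : (0 : ℝ) ≤ j := j.cast_nonneg
      push_cast; linarith
    rw [key, Real.sign_of_pos hj, abs_of_pos hj]
    simp
  · obtain ⟨j, hj⟩ := Int.eq_ofNat_of_zero_le (show 0 ≤ -m - 1 by omega)
    obtain rfl : m = -((j : ℤ) + 1) := by omega
    have hj : ((-((j : ℤ) + 1) : ℤ) : ℝ) + 1 / 2 = -(j + 1 / 2) := by push_cast; ring
    have hpos : (0 : ℝ) < j + 1 / 2 := by positivity
    rw [show 2 * -((j : ℤ) + 1) + 1 = -(2 * j + 1) by ring, sinExpIntegral_neg, key, hj,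
      Real.sign_of_neg (by linarith), abs_neg, abs_of_pos hpos, map_mul, Complex.conj_ofReal,
      Complex.conj_I]
    push_cast
    ring

/-- Since `(q + p + 2) c(q + 2) = (q - p) c(q)` for `c(q) = ‖sinExpIntegral p q‖` and `q ≥ p`, the
sequence `q (q + p) c(q)` decreases by `((2p - 2) q + 2p) c(q)`, so the series of `q c(q)`
telescopes. -/
theorem summable_mul_norm_sinExpIntegral {p : ℝ} (hp : 1 < p) {r : ℤ} (hr : p ≤ r) :
    Summable fun n : ℕ => ((r : ℝ) + 2 * n) * ‖sinExpIntegral p (r + 2 * n)‖ := by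
  set e : ℕ → ℝ := fun n => ((r : ℝ) + 2 * n) * (r + 2 * n + p) * ‖sinExpIntegral p (r + 2 * n)‖
    with he
  have hq : ∀ n : ℕ, p ≤ (r : ℝ) + 2 * n := fun n => by
    have : (0 : ℝ) ≤ n := n.cast_nonneg
    linarith
  have step : ∀ n : ℕ, ((r : ℝ) + 2 * n) * ‖sinExpIntegral p (r + 2 * n)‖ ≤
      (2 * p - 2)⁻¹ * (e n - e (n + 1)) := by
    intro n
    have h := congrArg norm (sinExpIntegral_add_two (show -1 < p by linarith) (r + 2 * n))
    have hqn := hq n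
    rw [norm_mul, norm_mul, Complex.norm_real, Complex.norm_real, Real.norm_eq_abs,
      Real.norm_eq_abs] at h
    push_cast at h
    rw [abs_of_nonneg (by linarith), abs_of_nonneg (by linarith)] at h
    have e2 : e (n + 1) = ((r : ℝ) + 2 * n + 2) *
        ((r + 2 * n - p) * ‖sinExpIntegral p (r + 2 * n)‖) := by
      simp only [he]
      rw [← h, show r + 2 * ((n + 1 : ℕ) : ℤ) = r + 2 * n + 2 by push_cast; ring]
      push_cast
      ring
    have hc := norm_nonneg (sinExpIntegral p (r + 2 * n))
    rw [e2, inv_mul_eq_div, le_div_iff₀ (by linarith)]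
    simp only [he]
    nlinarith [mul_nonneg (show 0 ≤ p by linarith) hc]
  have hpos : 0 < (2 * p - 2)⁻¹ := inv_pos.2 (by linarith)
  refine summable_of_sum_range_le (c := (2 * p - 2)⁻¹ * e 0) (fun n => ?_) (fun n => ?_)
  · exact mul_nonneg (by linarith [hq n]) (norm_nonneg _)
  · calc _ ≤ ∑ i ∈ Finset.range n, (2 * p - 2)⁻¹ * (e i - e (i + 1)) :=
          Finset.sum_le_sum fun i _ => step i
      _ = (2 * p - 2)⁻¹ * (e 0 - e n) := by rw [← Finset.mul_sum, Finset.sum_range_sub']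
      _ ≤ _ := by
          have : 0 ≤ e n := mul_nonneg (mul_nonneg (by linarith [hq n]) (by linarith [hq n]))
            (norm_nonneg _)
          gcongr
          linarith

theorem summable_nat_affine_mul_sinExpIntegral {p : ℝ} (hp : 1 < p) (k : ℤ) (a b : ℝ) :
    Summable fun n : ℕ => ‖((a + b * n : ℝ) : ℂ) * sinExpIntegral p (k + 2 * n)‖ := by
  obtain ⟨N, hN⟩ := exists_nat_ge (p + |(k : ℝ)|)
  rw [← summable_nat_add_iff N]
  have hr : p ≤ ((k + 2 * N : ℤ) : ℝ) := by
    push_cast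
    have := neg_abs_le (k : ℝ)
    have : (0 : ℝ) ≤ N := N.cast_nonneg
    linarith
  refine Summable.of_nonneg_of_le (fun n => norm_nonneg _) (fun n => ?_)
    ((summable_mul_norm_sinExpIntegral hp hr).mul_left (|a| + |b| * (1 + |(k : ℝ)|)))
  rw [norm_mul, Complex.norm_real, Real.norm_eq_abs,
    show k + 2 * ((n + N : ℕ) : ℤ) = k + 2 * N + 2 * n by push_cast; ring, ← mul_assoc]
  refine mul_le_mul_of_nonneg_right ?_ (norm_nonneg _)
  push_cast at hr ⊢
  set q : ℝ := k + 2 * N + 2 * n with hq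
  have hn : (0 : ℝ) ≤ n := n.cast_nonneg
  have hN' : (0 : ℝ) ≤ N := N.cast_nonneg
  have hq1 : 1 ≤ q := by linarith
  have hk := neg_abs_le (k : ℝ)
  have hk0 := abs_nonneg (k : ℝ)
  have h1 : (n : ℝ) + N ≤ (1 + |(k : ℝ)|) * q := by nlinarith
  calc |a + b * (n + N)| ≤ |a| + |b| * (n + N) := by
        refine (abs_add_le _ _).trans ?_
        rw [abs_mul, abs_of_nonneg (show (0 : ℝ) ≤ n + N by linarith)]
    _ ≤ |a| * q + |b| * ((1 + |(k : ℝ)|) * q) := by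
        have := abs_nonneg a
        gcongr
        nlinarith
    _ = _ := by ring

theorem summable_affine_mul_sinExpIntegral {p : ℝ} (hp : 1 < p) (k : ℤ) (a b : ℝ) :
    Summable fun l : ℤ => ‖((a + b * l : ℝ) : ℂ) * sinExpIntegral p (k - 2 * l)‖ := by
  refine Summable.of_nat_of_neg ?_ ?_
  · refine (summable_nat_affine_mul_sinExpIntegral hp (-k) a b).congr fun n => ?_
    rw [norm_mul, norm_mul, show k - 2 * (n : ℤ) = -(-k + 2 * n) by ring, sinExpIntegral_neg,
      RCLike.norm_conj]
    simp
  · refine (summable_nat_affine_mul_sinExpIntegral hp k a (-b)).congr fun n => ?_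
    rw [show k - 2 * (-(n : ℤ)) = k + 2 * n by ring]
    push_cast
    rw [neg_mul, mul_neg]

/-- The function `sin^α (2 cos + i k sin) e^{ik·}`: up to a constant, and for `α = 1`, the
second derivative of `e^{iks}` in the variable `x = L cot s`, multiplied by `dx/ds`. For general `α`
it also contains the factor `sin^(α-1)` that the kernel `|x - x'|^(1-α)` contributes. -/
noncomputable def sinDensity (α : ℝ) (k : ℤ) (t : ℝ) : ℂ :=
  ((Real.sin t ^ α : ℝ) : ℂ) * (2 * Real.cos t + Complex.I * k * Real.sin t) *
    Complex.exp (Complex.I * k * t)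

/-- The Fourier coefficients of `sinDensity α k` with respect to `e^{2ilt}` on `(0, π)`. -/
noncomputable def sinDensityCoeff (α : ℝ) (k l : ℤ) : ℂ :=
  Complex.I / (Real.pi * (α + 1)) * (((α - 1) * k + 4 * l : ℝ) * sinExpIntegral (α + 1) (k - 2 * l))

theorem exp_mul_exp_int (a b : ℤ) (t : ℝ) :
    Complex.exp (Complex.I * a * t) * Complex.exp (Complex.I * b * t) =
      Complex.exp (Complex.I * (a + b : ℤ) * t) := by
  rw [← Complex.exp_add]; congr 1; push_cast; ring

/-- The part of `2 cos + i k sin` proportional to the derivative in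
`integral_sin_rpow_mul_cos_add_sin` drops out, leaving a multiple of `sin^(α+1)`. -/
theorem integral_sinDensity_mul_exp {α : ℝ} (hα : 0 < α) (k l : ℤ) :
    ∫ t in (0 : ℝ)..Real.pi, sinDensity α k t * Complex.exp (Complex.I * (-(2 * l) : ℤ) * t) =
      Real.pi * sinDensityCoeff α k l := by
  have h := integral_sin_rpow_mul_cos_add_sin (show -1 < α by linarith) (k - 2 * l)
  have hα1 : (α : ℂ) + 1 ≠ 0 := by exact_mod_cast (show α + 1 ≠ 0 by linarith)
  have hpi : (Real.pi : ℂ) ≠ 0 := Complex.ofReal_ne_zero.2 Real.pi_ne_zero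
  have e : ∀ t ∈ Set.uIcc 0 Real.pi,
      sinDensity α k t * Complex.exp (Complex.I * (-(2 * l) : ℤ) * t) =
      2 / (α + 1) * (((Real.sin t ^ α : ℝ) : ℂ) * (((α + 1) * Real.cos t : ℂ) +
      Complex.I * (k - 2 * l : ℤ) * Real.sin t) * Complex.exp (Complex.I * (k - 2 * l : ℤ) * t)) +
      Complex.I * ((α - 1) * k + 4 * l) / (α + 1) * (((Real.sin t ^ (α + 1) : ℝ) : ℂ) *
        Complex.exp (Complex.I * (k - 2 * l : ℤ) * t)) := by
    intro t ht
    rw [Set.uIcc_of_le Real.pi_pos.le] at ht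
    rw [sinDensity, mul_assoc, exp_mul_exp_int, ← sub_eq_add_neg, Real.rpow_add_one'
      (Real.sin_nonneg_of_nonneg_of_le_pi ht.1 ht.2) (by linarith)]
    push_cast
    field_simp
    ring
  rw [intervalIntegral.integral_congr e, intervalIntegral.integral_add,
    intervalIntegral.integral_const_mul, intervalIntegral.integral_const_mul, h, mul_zero, zero_add,
    ← sinExpIntegral, sinDensityCoeff]
  · push_cast
    field_simp
  · simp only [mul_assoc]
    exact (intervalIntegrable_sin_rpow_mul (by linarith) (by fun_prop)).const_mul _
  · exact (intervalIntegrable_sin_rpow_mul (by linarith) (by fun_prop)).const_mul _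

theorem summable_norm_sinDensityCoeff {α : ℝ} (hα : 0 < α) (k : ℤ) :
    Summable fun l => ‖sinDensityCoeff α k l‖ := by
  have := (summable_affine_mul_sinExpIntegral (show 1 < α + 1 by linarith) k ((α - 1) * k) 4).mul_left
    ‖Complex.I / (Real.pi * (α + 1))‖
  refine this.congr fun l => ?_
  rw [sinDensityCoeff, ← norm_mul]

theorem continuous_sinDensity {α : ℝ} (hα : 0 < α) (k : ℤ) : Continuous (sinDensity α k) := by
  unfold sinDensity
  have : Continuous fun t => Real.sin t ^ α :=
    Real.continuous_sin.rpow_const fun _ => Or.inr hα.le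
  fun_prop

theorem hasSum_sinDensity {α : ℝ} (hα : 0 < α) (k : ℤ) {t : ℝ} (ht : t ∈ Set.Ico 0 Real.pi) :
    HasSum (fun l : ℤ => sinDensityCoeff α k l * Complex.exp (Complex.I * (2 * l : ℤ) * t))
      (sinDensity α k t) := by
  have : Fact (0 < Real.pi) := ⟨Real.pi_pos⟩
  have hc : Continuous (AddCircle.liftIco Real.pi 0 (sinDensity α k)) := by
    refine AddCircle.liftIco_zero_continuous ?_ (continuous_sinDensity hα k).continuousOn
    simp [sinDensity, Real.zero_rpow hα.ne']
  have hpi : (Real.pi : ℂ) ≠ 0 := Complex.ofReal_ne_zero.2 Real.pi_ne_zero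
  have hfour : ∀ (n : ℤ) (x : ℝ), (fourier n : C(AddCircle Real.pi, ℂ)) (x : AddCircle Real.pi) =
      Complex.exp (Complex.I * (2 * n : ℤ) * x) := by
    intro n x
    rw [fourier_coe_apply]
    congr 1
    push_cast
    field_simp
  have hcoeff : fourierCoeff (AddCircle.liftIco Real.pi 0 (sinDensity α k)) =
      sinDensityCoeff α k := by
    ext l
    rw [fourierCoeff_liftIco_eq, fourierCoeffOn_eq_integral]
    have e : ∀ x : ℝ, Complex.exp (2 * Real.pi * Complex.I * (-l : ℤ) * x / Real.pi) =
        Complex.exp (Complex.I * (-(2 * l) : ℤ) * x) := by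
      intro x
      congr 1
      push_cast
      field_simp
    simp only [fourier_coe_apply, e, zero_add, smul_eq_mul, sub_zero]
    have := integral_sinDensity_mul_exp hα k l
    simp only [mul_comm (sinDensity α k _)] at this
    rw [this, Complex.real_smul]
    push_cast
    field_simp
  have := has_pointwise_sum_fourier_series_of_summable
    (f := ⟨AddCircle.liftIco Real.pi 0 (sinDensity α k), hc⟩)
    (by
      rw [ContinuousMap.coe_mk, hcoeff]
      exact (summable_norm_sinDensityCoeff hα k).of_norm) (t : AddCircle Real.pi)
  simp only [ContinuousMap.coe_mk, hcoeff, hfour, smul_eq_mul] at this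
  rwa [AddCircle.liftIco_coe_apply (by simpa using ht)] at this

/-- Since the Fourier series of `sinDensity α k` converges absolutely and uniformly, it may be
integrated term by term against any integrable weight, singular or not. -/
theorem hasSum_integral_sinDensity_mul {α : ℝ} (hα : 0 < α) (k : ℤ) {w : ℝ → ℂ}
    (hw : IntervalIntegrable w volume 0 Real.pi) :
    HasSum (fun l : ℤ => sinDensityCoeff α k l *
        ∫ t in (0 : ℝ)..Real.pi, Complex.exp (Complex.I * (2 * l : ℤ) * t) * w t)
      (∫ t in (0 : ℝ)..Real.pi, sinDensity α k t * w t) := by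
  simp only [← intervalIntegral.integral_const_mul]
  refine intervalIntegral.hasSum_integral_of_dominated_convergence
    (fun l t => ‖sinDensityCoeff α k l‖ * ‖w t‖) (fun l => ?_) (fun l => ?_) ?_ ?_ ?_
  · rw [Set.uIoc_of_le Real.pi_pos.le]
    exact (((continuous_exp_I_mul_int_mul (2 * l)).aestronglyMeasurable).mul
      hw.1.aestronglyMeasurable).const_mul _
  · refine ae_of_all _ fun t _ => ?_
    rw [norm_mul, norm_mul, norm_exp_I_mul_int_mul, one_mul]
  · exact ae_of_all _ fun t _ => (summable_norm_sinDensityCoeff hα k).mul_right _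
  · simp only [tsum_mul_right]
    exact hw.norm.const_mul _
  -- The expansion holds on `[0, π)`; the endpoint `π` is a null set.
  · have hne : ∀ᵐ t : ℝ, t ≠ Real.pi := by simp [ae_iff]
    filter_upwards [hne] with t ht ht2
    rw [Set.uIoc_of_le Real.pi_pos.le] at ht2
    have := (hasSum_sinDensity hα k (t := t) ⟨ht2.1.le, lt_of_le_of_ne ht2.2 ht⟩).mul_right (w t)
    simpa only [mul_assoc] using this

/-! ### The change of variable `x = L cot s` -/

theorem angle_eq_pi_div_two_sub_arctan {L : ℝ} (hL : 0 < L) (x : ℝ) :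
    angle L x = Real.pi / 2 - Real.arctan (x / L) := by
  rw [angle, Real.arccos, Real.arctan_eq_arcsin]
  congr 2
  have h : L ^ 2 + x ^ 2 = L ^ 2 * (1 + (x / L) ^ 2) := by field_simp
  rw [h, Real.sqrt_mul (by positivity), Real.sqrt_sq hL.le]
  have : 0 < √(1 + (x / L) ^ 2) := Real.sqrt_pos.2 (by positivity)
  field_simp

theorem hasDerivAt_angle {L : ℝ} (hL : 0 < L) (x : ℝ) :
    HasDerivAt (angle L) (-L / (L ^ 2 + x ^ 2)) x := by
  rw [funext (angle_eq_pi_div_two_sub_arctan hL)]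
  have := (((hasDerivAt_id x).div_const L).arctan).const_sub (Real.pi / 2)
  refine this.congr_deriv ?_
  have : L ^ 2 + x ^ 2 ≠ 0 := by positivity
  simp only [id]
  field_simp

theorem angle_mem_Ioo {L : ℝ} (hL : 0 < L) (x : ℝ) : angle L x ∈ Set.Ioo 0 Real.pi := by
  rw [angle_eq_pi_div_two_sub_arctan hL]
  constructor
  · linarith [Real.arctan_lt_pi_div_two (x / L)]
  · linarith [Real.neg_pi_div_two_lt_arctan (x / L)]

theorem mul_cot_angle {L : ℝ} (hL : 0 < L) (x : ℝ) : L * Real.cot (angle L x) = x := by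
  rw [angle_eq_pi_div_two_sub_arctan hL, Real.cot_eq_cos_div_sin, Real.cos_pi_div_two_sub,
    Real.sin_pi_div_two_sub, ← Real.tan_eq_sin_div_cos, Real.tan_arctan]
  field_simp

theorem image_mul_cot {L : ℝ} (hL : 0 < L) :
    (fun t => L * Real.cot t) '' Set.Ioo 0 Real.pi = Set.univ :=
  Set.eq_univ_of_forall fun x => ⟨angle L x, angle_mem_Ioo hL x, mul_cot_angle hL x⟩

theorem injOn_mul_cot {L : ℝ} (hL : 0 < L) :
    Set.InjOn (fun t => L * Real.cot t) (Set.Ioo 0 Real.pi) := by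
  intro a ha b hb hab
  rw [← angle_cot hL ha, ← angle_cot hL hb]
  exact congrArg (angle L) hab

theorem hasDerivAt_mul_cot (L : ℝ) {t : ℝ} (ht : t ∈ Set.Ioo 0 Real.pi) :
    HasDerivAt (fun t => L * Real.cot t) (-L / Real.sin t ^ 2) t := by
  have hs := (Real.sin_pos_of_mem_Ioo ht).ne'
  have h := ((Real.hasDerivAt_cos t).div (Real.hasDerivAt_sin t) hs).const_mul L
  rw [show (fun t => L * Real.cot t) = fun t => L * (Real.cos / Real.sin) t from
    funext fun t => by rw [Real.cot_eq_cos_div_sin]; rfl]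
  refine h.congr_deriv ?_
  field_simp
  linear_combination -L * Real.sin_sq_add_cos_sq t

/-- The first derivative of `fourierMode L k`. -/
noncomputable def fourierModeDeriv (L : ℝ) (k : ℤ) (x : ℝ) : ℂ :=
  -(Complex.I * k * L) / (L ^ 2 + x ^ 2) * fourierMode L k x

/-- The second derivative of `fourierMode L k`. -/
noncomputable def fourierModeDerivTwo (L : ℝ) (k : ℤ) (x : ℝ) : ℂ :=
  Complex.I * k * L * (2 * x + Complex.I * k * L) / (L ^ 2 + x ^ 2) ^ 2 * fourierMode L k x

theorem ofReal_sq_add_sq_ne_zero {L : ℝ} (hL : 0 < L) (x : ℝ) : (L : ℂ) ^ 2 + (x : ℂ) ^ 2 ≠ 0 := by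
  exact_mod_cast (show L ^ 2 + x ^ 2 ≠ 0 by positivity)

theorem hasDerivAt_fourierMode {L : ℝ} (hL : 0 < L) (k : ℤ) (x : ℝ) :
    HasDerivAt (fourierMode L k) (fourierModeDeriv L k x) x := by
  have h := (((hasDerivAt_angle hL x).ofReal_comp).const_mul (Complex.I * (k : ℂ))).cexp
  refine h.congr_deriv ?_
  rw [fourierModeDeriv, fourierMode]
  push_cast
  ring

theorem hasDerivAt_fourierModeDeriv {L : ℝ} (hL : 0 < L) (k : ℤ) (x : ℝ) :
    HasDerivAt (fourierModeDeriv L k) (fourierModeDerivTwo L k x) x := by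
  have hD : HasDerivAt (fun x : ℝ => (L : ℂ) ^ 2 + (x : ℂ) ^ 2) (2 * x) x := by
    have := ((hasDerivAt_pow 2 x).const_add (L ^ 2)).ofReal_comp
    simpa using this
  have hne := ofReal_sq_add_sq_ne_zero hL x
  have h := ((hasDerivAt_const x (-(Complex.I * k * L))).div hD hne).mul
    (hasDerivAt_fourierMode hL k x)
  refine h.congr_deriv ?_
  rw [fourierModeDeriv, fourierModeDerivTwo]
  field_simp
  simp only [Pi.div_apply]
  field_simp
  ring

theorem norm_fourierMode (L : ℝ) (k : ℤ) (x : ℝ) : ‖fourierMode L k x‖ = 1 :=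
  norm_exp_I_mul_int_mul k _

theorem norm_ofReal_sq_add_sq {L : ℝ} (x : ℝ) :
    ‖(L : ℂ) ^ 2 + (x : ℂ) ^ 2‖ = L ^ 2 + x ^ 2 := by
  rw [show (L : ℂ) ^ 2 + (x : ℂ) ^ 2 = ((L ^ 2 + x ^ 2 : ℝ) : ℂ) by push_cast; ring,
    Complex.norm_real, Real.norm_eq_abs, abs_of_nonneg (by positivity)]

theorem sq_mul_norm_fourierModeDeriv_le {L : ℝ} (hL : 0 < L) (k : ℤ) (x : ℝ) :
    x ^ 2 * ‖fourierModeDeriv L k x‖ ≤ |(k : ℝ)| * L := by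
  have hD : 0 < L ^ 2 + x ^ 2 := by positivity
  rw [fourierModeDeriv, norm_mul, norm_div, norm_fourierMode, norm_ofReal_sq_add_sq, mul_one]
  simp only [norm_neg, norm_mul, Complex.norm_I, Complex.norm_intCast, Complex.norm_real,
    Real.norm_eq_abs, one_mul, abs_of_pos hL]
  rw [mul_div_assoc', div_le_iff₀ hD]
  nlinarith [mul_nonneg (abs_nonneg (k : ℝ)) hL.le, sq_nonneg L]

theorem norm_fourierModeDerivTwo_le {L : ℝ} (hL : 0 < L) (k : ℤ) (x : ℝ) :
    ‖fourierModeDerivTwo L k x‖ ≤ |(k : ℝ)| * (1 + |(k : ℝ)|) / L ^ 2 := by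
  have hD : 0 < L ^ 2 + x ^ 2 := by positivity
  have hk := abs_nonneg (k : ℝ)
  rw [fourierModeDerivTwo, norm_mul, norm_div, norm_fourierMode, norm_pow, norm_ofReal_sq_add_sq,
    mul_one]
  have h1 : ‖2 * (x : ℂ) + Complex.I * k * L‖ ≤ 2 * |x| + |(k : ℝ)| * L := by
    refine (norm_add_le _ _).trans (le_of_eq ?_)
    simp [abs_of_pos hL]
  have h2 : L * (2 * |x| + |(k : ℝ)| * L) ≤ (1 + |(k : ℝ)|) * (L ^ 2 + x ^ 2) := by
    nlinarith [sq_nonneg (L - |x|), sq_abs x, mul_nonneg hk (sq_nonneg x)]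
  rw [div_le_div_iff₀ (by positivity) (by positivity), norm_mul]
  simp only [norm_mul, Complex.norm_I, Complex.norm_intCast, Complex.norm_real,
    Real.norm_eq_abs, one_mul, abs_of_pos hL]
  calc |(k : ℝ)| * L * ‖2 * (x : ℂ) + Complex.I * k * L‖ * L ^ 2
      ≤ |(k : ℝ)| * L * (2 * |x| + |(k : ℝ)| * L) * L ^ 2 := by gcongr
    _ = |(k : ℝ)| * (L * (2 * |x| + |(k : ℝ)| * L)) * L ^ 2 := by ring
    _ ≤ |(k : ℝ)| * ((1 + |(k : ℝ)|) * (L ^ 2 + x ^ 2)) * (L ^ 2 + x ^ 2) := by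
        gcongr
        nlinarith [sq_nonneg x]
    _ = _ := by ring

theorem abs_mul_cot_sub_mul_cot {L s t : ℝ} (hL : 0 < L) (hs : s ∈ Set.Ioo 0 Real.pi)
    (ht : t ∈ Set.Ioo 0 Real.pi) :
    |L * Real.cot t - L * Real.cot s| = L * |Real.sin (s - t)| / (Real.sin s * Real.sin t) := by
  have h1 := Real.sin_pos_of_mem_Ioo hs
  have h2 := Real.sin_pos_of_mem_Ioo ht
  rw [Real.cot_eq_cos_div_sin, Real.cot_eq_cos_div_sin, Real.sin_sub,
    show L * (Real.cos t / Real.sin t) - L * (Real.cos s / Real.sin s) =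
      L * (Real.sin s * Real.cos t - Real.cos s * Real.sin t) / (Real.sin s * Real.sin t) by
      field_simp, abs_div, abs_mul, abs_of_pos hL, abs_of_pos (mul_pos h1 h2)]

/-- In the variable `t`, `d²/dx² e^{ikt} dx` is `(i k / L) sin t (2 cos t + i k sin t) e^{ikt} dt`. -/
theorem abs_deriv_smul_fourierModeDerivTwo {L : ℝ} (hL : 0 < L) (k : ℤ) {t : ℝ}
    (ht : t ∈ Set.Ioo 0 Real.pi) :
    ((|-L / Real.sin t ^ 2| : ℝ) : ℂ) * fourierModeDerivTwo L k (L * Real.cot t) =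
      Complex.I * k / L * sinDensity 1 k t := by
  have hs := Real.sin_pos_of_mem_Ioo ht
  have hsc : (Real.sin t : ℂ) ≠ 0 := Complex.ofReal_ne_zero.2 hs.ne'
  have hLc : (L : ℂ) ≠ 0 := Complex.ofReal_ne_zero.2 hL.ne'
  have hD : (L : ℂ) ^ 2 + ((L * Real.cot t : ℝ) : ℂ) ^ 2 = (L : ℂ) ^ 2 / (Real.sin t : ℂ) ^ 2 := by
    rw [Real.cot_eq_cos_div_sin]
    have := Real.sin_sq_add_cos_sq t
    have : (Real.sin t : ℂ) ^ 2 + (Real.cos t : ℂ) ^ 2 = 1 := by exact_mod_cast this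
    rw [Complex.ofReal_mul, Complex.ofReal_div]
    field_simp
    linear_combination this
  rw [fourierModeDerivTwo, hD, fourierMode, angle_cot hL ht, sinDensity, abs_div, abs_neg,
    abs_of_pos hL, abs_of_pos (pow_pos hs 2), Real.cot_eq_cos_div_sin, Real.rpow_one,
    Complex.ofReal_mul, Complex.ofReal_div, Complex.ofReal_div, Complex.ofReal_pow]
  field_simp

/-- The fractional Laplacian of `e^{iks}` as an integral over `(0, π)`. The weight `w` stands for the
kernel `Ψ` after the substitution, divided by the power `sin^(α-1)` that `sinDensity α k` absorbs.
The point `t = s`, where the kernel is singular, is excluded from the comparison. -/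
theorem hasFracLaplacianAt_fourierMode {α L s : ℝ} (hα : 0 < α) (hL : 0 < L) (k : ℤ)
    (hs : s ∈ Set.Ioo 0 Real.pi) {Ψ ψ : ℝ → ℝ} {w : ℝ → ℂ}
    (hΨ : ∀ y, 0 < y → HasDerivAt Ψ (ψ y) y)
    (hψ : ∀ y, 0 < y → HasDerivAt ψ (-(y ^ (-1 - α))) y)
    (lψ0 : Tendsto (fun y => y ^ 2 * ψ y) (𝓝[>] 0) (𝓝 0))
    (lΨ0 : Tendsto (fun y => y * Ψ y) (𝓝[>] 0) (𝓝 0))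
    (lψ : Tendsto ψ atTop (𝓝 0)) (lΨ : Tendsto (fun y => Ψ y / y ^ 2) atTop (𝓝 0))
    (hw : IntervalIntegrable w volume 0 Real.pi)
    (hwΨ : ∀ t ∈ Set.Ioo 0 Real.pi, t ≠ s →
      sinDensity 1 k t * (Ψ (L * |Real.sin (s - t)| / (Real.sin s * Real.sin t)) : ℂ) =
        sinDensity α k t * w t) :
    HasFracLaplacianAt α (fourierMode L k) (L * Real.cot s)
      (fracConst α * (Complex.I * k / L * ∫ t in (0 : ℝ)..Real.pi, sinDensity α k t * w t)) := by
  have hd : ∀ t ∈ Set.Ioo 0 Real.pi, HasDerivWithinAt (fun t => L * Real.cot t)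
      (-L / Real.sin t ^ 2) (Set.Ioo 0 Real.pi) t :=
    fun t ht => (hasDerivAt_mul_cot L ht).hasDerivWithinAt
  set f : ℝ → ℂ := fun z => fourierModeDerivTwo L k z * (Ψ |z - L * Real.cot s| : ℂ) with hf
  have hfw : ∀ᵐ t ∂(volume.restrict (Set.Ioo 0 Real.pi)),
      |-L / Real.sin t ^ 2| • f (L * Real.cot t) =
        Complex.I * k / L * (sinDensity α k t * w t) := by
    have hne : ∀ᵐ t : ℝ ∂(volume.restrict (Set.Ioo 0 Real.pi)), t ≠ s :=
      ae_restrict_of_ae (by simp [ae_iff])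
    filter_upwards [hne, ae_restrict_mem measurableSet_Ioo] with t hts ht
    simp only [hf]
    rw [Complex.real_smul, ← mul_assoc, abs_deriv_smul_fourierModeDerivTwo hL k ht,
      abs_mul_cot_sub_mul_cot hL hs ht, mul_assoc, hwΨ t ht hts]
  have hint' : IntegrableOn (fun t => Complex.I * k / L * (sinDensity α k t * w t))
      (Set.Ioo 0 Real.pi) := by
    rw [← intervalIntegrable_iff_integrableOn_Ioo_of_le Real.pi_pos.le]
    exact (hw.continuousOn_mul (continuous_sinDensity hα k).continuousOn).const_mul _
  have hint : Integrable f := by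
    rw [← integrableOn_univ, ← image_mul_cot hL,
      integrableOn_image_iff_integrableOn_abs_deriv_smul measurableSet_Ioo hd (injOn_mul_cot hL)]
    exact hint'.congr (hfw.mono fun t ht => ht.symm)
  have hval : ∫ z, f z = Complex.I * k / L * ∫ t in (0 : ℝ)..Real.pi, sinDensity α k t * w t := by
    rw [← setIntegral_univ, ← image_mul_cot hL,
      integral_image_eq_integral_abs_deriv_smul measurableSet_Ioo hd (injOn_mul_cot hL),
      integral_congr_ae hfw, integral_const_mul, intervalIntegral.integral_of_le Real.pi_pos.le,
      integral_Ioc_eq_integral_Ioo]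
  rw [← hval]
  have hk := abs_nonneg (k : ℝ)
  have hk1 : 0 ≤ |(k : ℝ)| * L := by positivity
  have hk2 : 0 ≤ |(k : ℝ)| * (1 + |(k : ℝ)|) / L ^ 2 := by positivity
  refine hasFracLaplacianAt_of_kernel (C := 1 + |(k : ℝ)| * L + |(k : ℝ)| * (1 + |(k : ℝ)|) / L ^ 2)
    hα (hasDerivAt_fourierMode hL k) (hasDerivAt_fourierModeDeriv hL k) (fun z => ?_) (fun z => ?_)
    (fun z => ?_) hΨ hψ lψ0 lΨ0 lψ lΨ hint
  · rw [norm_fourierMode]; linarith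
  · linarith [sq_mul_norm_fourierModeDeriv_le hL k z]
  · linarith [norm_fourierModeDerivTwo_le hL k z]

theorem periodic_comp_abs_sin (g : ℝ → ℂ) :
    Function.Periodic (fun t => g |Real.sin t|) Real.pi := by
  intro t
  simp [Real.sin_add_pi]

theorem intervalIntegrable_comp_abs_sin {g : ℝ → ℂ}
    (hg : IntervalIntegrable (fun t => g (Real.sin t)) volume 0 Real.pi) (a b : ℝ) :
    IntervalIntegrable (fun t => g |Real.sin t|) volume a b := by
  refine (periodic_comp_abs_sin g).intervalIntegrable (t := 0) Real.pi_pos.ne' ?_ a b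
  rw [zero_add]
  refine hg.congr fun t ht => ?_
  rw [Set.uIoc_of_le Real.pi_pos.le] at ht
  rw [abs_of_nonneg (Real.sin_nonneg_of_nonneg_of_le_pi ht.1.le ht.2)]

theorem intervalIntegrable_comp_abs_sin_sub {g : ℝ → ℂ}
    (hg : IntervalIntegrable (fun t => g (Real.sin t)) volume 0 Real.pi) (s : ℝ) :
    IntervalIntegrable (fun t => g |Real.sin (s - t)|) volume 0 Real.pi := by
  have := (intervalIntegrable_comp_abs_sin hg (s - 0) (s - Real.pi)).comp_sub_left s
  simpa using this

/-- Convolution of `e^{2il·}` with a `π`-periodic even function of `sin`. -/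
theorem integral_exp_mul_comp_abs_sin_sub (g : ℝ → ℂ) (l : ℤ) (s : ℝ) :
    ∫ t in (0 : ℝ)..Real.pi, Complex.exp (Complex.I * (2 * l : ℤ) * t) * g |Real.sin (s - t)| =
      Complex.exp (Complex.I * 2 * l * s) *
        ∫ t in (0 : ℝ)..Real.pi, g (Real.sin t) * Complex.exp (Complex.I * (2 * l : ℤ) * t) := by
  set F : ℝ → ℂ := fun t => Complex.exp (Complex.I * (2 * l : ℤ) * t) * g |Real.sin t| with hF
  have hper : Function.Periodic F Real.pi := by
    intro t
    simp only [hF]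
    rw [Real.sin_add_pi, abs_neg]
    congr 1
    rw [show Complex.I * ((2 * l : ℤ) : ℂ) * ((t + Real.pi : ℝ) : ℂ) =
      Complex.I * ((2 * l : ℤ) : ℂ) * t + l * (2 * Real.pi * Complex.I) by push_cast; ring,
      Complex.exp_add, Complex.exp_int_mul_two_pi_mul_I, mul_one]
  have e1 : ∀ t : ℝ, Complex.exp (Complex.I * (2 * l : ℤ) * t) * g |Real.sin (s - t)| =
      Complex.exp (Complex.I * 2 * l * s) * F (t - s) := by
    intro t
    simp only [hF]
    rw [← mul_assoc, ← Complex.exp_add, ← abs_neg (Real.sin (s - t)), ← Real.sin_neg, neg_sub]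
    congr 2
    push_cast
    ring
  simp only [e1]
  rw [intervalIntegral.integral_const_mul, intervalIntegral.integral_comp_sub_right]
  congr 1
  have h := hper.intervalIntegral_add_eq (0 - s) 0
  rw [show 0 - s + Real.pi = Real.pi - s by ring, zero_add] at h
  rw [h]
  refine intervalIntegral.integral_congr fun t ht => ?_
  rw [Set.uIcc_of_le Real.pi_pos.le] at ht
  simp only [hF]
  rw [abs_of_nonneg (Real.sin_nonneg_of_nonneg_of_le_pi ht.1 ht.2), mul_comm]

/-! ### The case `α ≠ 1` -/

theorem sin_ne_zero_and_cos_ne_zero {α : ℝ} (h0 : 0 < α) (h2 : α < 2) (h1 : α ≠ 1) :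
    Real.sin (Real.pi * α / 2) ≠ 0 ∧ Real.cos (Real.pi * α / 2) ≠ 0 := by
  have hpi := Real.pi_pos
  constructor
  · refine (Real.sin_pos_of_pos_of_lt_pi ?_ ?_).ne' <;> nlinarith
  · rcases lt_or_gt_of_ne h1 with h | h
    · exact (Real.cos_pos_of_mem_Ioo ⟨by nlinarith, by nlinarith⟩).ne'
    · exact (Real.cos_neg_of_pi_div_two_lt_of_lt (by nlinarith) (by nlinarith)).ne

/-- The constant in the product of the Fourier coefficients for even `k`: the reflection formula gives the
factor `1 / tan (π α / 2)`. -/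
theorem gamma_constant_even {α : ℝ} (h0 : 0 < α) (h2 : α < 2) (h1 : α ≠ 1) :
    (√Real.pi * Real.Gamma ((α + 1 + 1) / 2) / Real.Gamma (-(α + 1) / 2)) *
      (√Real.pi * Real.Gamma ((1 - α + 1) / 2) / Real.Gamma (-(1 - α) / 2)) =
      Real.pi * (α * (1 - α) * (1 + α)) / (8 * Real.tan (Real.pi * α / 2)) := by
  have e1 : Real.Gamma ((α + 1 + 1) / 2) = α / 2 * Real.Gamma (α / 2) := by
    rw [← Real.Gamma_add_one (by positivity)]; congr 1; ring
  have e2 : Real.Gamma ((1 - α) / 2) = -(α + 1) / 2 * Real.Gamma (-(α + 1) / 2) := by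
    rw [← Real.Gamma_add_one (by linarith)]; congr 1; ring
  have e3 : Real.Gamma ((1 + α) / 2) = -(1 - α) / 2 * Real.Gamma (-(1 - α) / 2) := by
    rw [← Real.Gamma_add_one (by intro h; apply h1; linarith)]; congr 1; ring
  have r1 := Real.Gamma_mul_Gamma_one_sub (α / 2)
  have r2 := Real.Gamma_mul_Gamma_one_sub ((1 + α) / 2)
  rw [show 1 - (1 + α) / 2 = (1 - α) / 2 by ring, e2, e3,
    show Real.pi * ((1 + α) / 2) = Real.pi * α / 2 + Real.pi / 2 by ring,
    Real.sin_add_pi_div_two] at r2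
  rw [show Real.pi * (α / 2) = Real.pi * α / 2 by ring, show 1 - α / 2 = (1 - α + 1) / 2 by ring] at r1
  have hpi := Real.pi_pos
  obtain ⟨hs, hc⟩ := sin_ne_zero_and_cos_ne_zero h0 h2 h1
  have hx : Real.Gamma (-(α + 1) / 2) ≠ 0 := by
    refine Real.Gamma_ne_zero fun m hm => ?_
    rcases lt_trichotomy m 1 with h | rfl | h
    · obtain rfl : m = 0 := by omega
      push_cast at hm; linarith
    · apply h1; push_cast at hm; linarith
    · have : (2 : ℝ) ≤ m := by exact_mod_cast h
      linarith
  have hy : Real.Gamma (-(1 - α) / 2) ≠ 0 := by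
    refine Real.Gamma_ne_zero fun m hm => ?_
    rcases m.eq_zero_or_pos with rfl | h
    · apply h1; push_cast at hm; linarith
    · have : (1 : ℝ) ≤ m := by exact_mod_cast h
      linarith
  rw [e1, Real.tan_eq_sin_div_cos]
  have hsq : √Real.pi * √Real.pi = Real.pi := Real.mul_self_sqrt hpi.le
  generalize Real.Gamma (-(α + 1) / 2) = x at *
  generalize Real.Gamma (-(1 - α) / 2) = y at *
  generalize Real.Gamma (α / 2) = z at *
  generalize Real.Gamma ((1 - α + 1) / 2) = v at *
  rw [eq_div_iff hs] at r1
  rw [eq_div_iff hc] at r2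
  rw [div_mul_div_comm, mul_div_assoc', div_div_eq_mul_div, div_eq_div_iff (mul_ne_zero hx hy)
    (mul_ne_zero (by norm_num) hs)]
  linear_combination (4 * α * z * v * Real.sin (Real.pi * α / 2)) * hsq +
    4 * Real.pi * α * r1 - 4 * Real.pi * α * r2

/-- The constant in the product of the Fourier coefficients for odd `k`: the functional equation of
`Γ` suffices here. -/
theorem gamma_constant_odd {α : ℝ} (h0 : 0 < α) (h2 : α < 2) (h1 : α ≠ 1) :
    (√Real.pi * Real.Gamma ((α + 1) / 2 + 1) / Real.Gamma ((1 - (α + 1)) / 2)) *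
      (√Real.pi * Real.Gamma ((1 - α + 1) / 2) / Real.Gamma (-(1 - α) / 2)) =
      Real.pi * (α * (1 - α) * (1 + α)) / 8 := by
  have hne : -(1 - α) / 2 ≠ 0 := by
    intro h; apply h1; linarith
  have e1 : Real.Gamma ((α + 1) / 2 + 1) = (α + 1) / 2 * (-(1 - α) / 2 * Real.Gamma (-(1 - α) / 2)) := by
    rw [Real.Gamma_add_one (by positivity), ← Real.Gamma_add_one hne]
    congr 2; ring
  have e2 : Real.Gamma ((1 - α + 1) / 2) = (1 - (α + 1)) / 2 * Real.Gamma ((1 - (α + 1)) / 2) := by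
    rw [← Real.Gamma_add_one (by intro h; apply h0.ne'; linarith)]; congr 1; ring
  have hx : Real.Gamma ((1 - (α + 1)) / 2) ≠ 0 := by
    refine Real.Gamma_ne_zero fun m hm => ?_
    rcases m.eq_zero_or_pos with rfl | h
    · push_cast at hm; linarith
    · have : (1 : ℝ) ≤ m := by exact_mod_cast h
      linarith
  have hy : Real.Gamma (-(1 - α) / 2) ≠ 0 := by
    refine Real.Gamma_ne_zero fun m hm => ?_
    rcases m.eq_zero_or_pos with rfl | h
    · apply h1; push_cast at hm; linarith
    · have : (1 : ℝ) ≤ m := by exact_mod_cast h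
      linarith
  have hsq : √Real.pi * √Real.pi = Real.pi := Real.mul_self_sqrt Real.pi_pos.le
  rw [e1, e2]
  generalize Real.Gamma (-(1 - α) / 2) = y at *
  generalize Real.Gamma ((1 - (α + 1)) / 2) = x at *
  rw [div_mul_div_comm, div_eq_div_iff (mul_ne_zero hx hy) (by norm_num)]
  linear_combination (2 * (α + 1) * (1 - α) * α * x * y) / 2 * hsq

theorem sinExpIntegral_mul_even {α : ℝ} (h0 : 0 < α) (h2 : α < 2) (h1 : α ≠ 1) {k : ℤ}
    (hk : Even k) (l : ℤ) :
    sinExpIntegral (α + 1) (k - 2 * l) * sinExpIntegral (1 - α) (2 * l) =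
      ((Real.pi * (α * (1 - α) * (1 + α)) / (8 * Real.tan (Real.pi * α / 2)) *
        gammaRatio α k l : ℝ) : ℂ) := by
  obtain ⟨n, rfl⟩ := hk
  have e : n + n - 2 * l = 2 * (n - l) := by ring
  have p1 : ∀ j : ℕ, (2 * j : ℝ) ≠ α + 1 := by
    intro j hj
    rcases lt_trichotomy j 1 with h | rfl | h
    · obtain rfl : j = 0 := by omega
      push_cast at hj; linarith
    · apply h1; push_cast at hj; linarith
    · have : (2 : ℝ) ≤ j := by exact_mod_cast h
      linarith
  have p2 : ∀ j : ℕ, (2 * j : ℝ) ≠ 1 - α := by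
    intro j hj
    rcases j.eq_zero_or_pos with rfl | h
    · apply h1; push_cast at hj; linarith
    · have : (1 : ℝ) ≤ j := by exact_mod_cast h
      linarith
  rw [e, sinExpIntegral_even (by linarith) p1, sinExpIntegral_even (by linarith) p2,
    ← Complex.ofReal_mul, ← gamma_constant_even h0 h2 h1, gammaRatio]
  congr 1
  have a1 : (((n + n : ℤ) : ℝ) / 2 - l) = ((n - l : ℤ) : ℝ) := by push_cast; ring
  rw [a1, show (-1 + α) / 2 = -(1 - α) / 2 by ring, show (-1 - α) / 2 = -(α + 1) / 2 by ring,
    show (3 - α) / 2 = (1 - α) / 2 + 1 by ring, show (3 + α) / 2 = (α + 1) / 2 + 1 by ring]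
  ring

theorem sinExpIntegral_mul_odd {α : ℝ} (h0 : 0 < α) (h2 : α < 2) (h1 : α ≠ 1) {k : ℤ}
    (hk : Odd k) (l : ℤ) :
    sinExpIntegral (α + 1) (k - 2 * l) * sinExpIntegral (1 - α) (2 * l) =
      Complex.I * (Real.sign ((k : ℝ) / 2 - l) : ℂ) *
        ((Real.pi * (α * (1 - α) * (1 + α)) / 8 * gammaRatio α k l : ℝ) : ℂ) := by
  obtain ⟨n, rfl⟩ := hk
  have e : 2 * n + 1 - 2 * l = 2 * (n - l) + 1 := by ring
  have p1 : ∀ j : ℕ, (2 * j + 1 : ℝ) ≠ α + 1 := by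
    intro j hj
    rcases j.eq_zero_or_pos with rfl | h
    · push_cast at hj; linarith
    · have : (1 : ℝ) ≤ j := by exact_mod_cast h
      linarith
  have p2 : ∀ j : ℕ, (2 * j : ℝ) ≠ 1 - α := by
    intro j hj
    rcases j.eq_zero_or_pos with rfl | h
    · apply h1; push_cast at hj; linarith
    · have : (1 : ℝ) ≤ j := by exact_mod_cast h
      linarith
  rw [e, sinExpIntegral_odd (by linarith) p1, sinExpIntegral_even (by linarith) p2, mul_assoc,
    ← Complex.ofReal_mul, ← gamma_constant_odd h0 h2 h1, gammaRatio]
  have a1 : (((2 * n + 1 : ℤ) : ℝ) / 2 - l) = ((n - l : ℤ) : ℝ) + 1 / 2 := by push_cast; ring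
  rw [a1, show (-1 + α) / 2 = -(1 - α) / 2 by ring, show (-1 - α) / 2 = -(α + 1) / 2 by ring,
    show (3 - α) / 2 = (1 - α) / 2 + 1 by ring, show (3 + α) / 2 = (α + 1) / 2 + 1 by ring]
  congr 2
  ring

/-- Here the kernel is `y^(1-α) / (α (1-α))`, a twofold primitive of `-y^(-1-α)`. The series is left in
terms of `sinExpIntegral`, which treats even and odd `k` together. -/
theorem hasSum_fracLaplacian_fourierMode_of_ne_one {α L s : ℝ} (h0 : 0 < α) (h2 : α < 2)
    (h1 : α ≠ 1) (hL : 0 < L) (k : ℤ) (hs : s ∈ Set.Ioo 0 Real.pi) :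
    ∃ S : ℂ, HasSum (fun l : ℤ => sinDensityCoeff α k l *
        (Complex.exp (Complex.I * 2 * l * s) * sinExpIntegral (1 - α) (2 * l))) S ∧
      HasFracLaplacianAt α (fourierMode L k) (L * Real.cot s)
        (fracConst α * (Complex.I * k / L *
          (((L ^ (1 - α) * Real.sin s ^ (α - 1) / (α * (1 - α)) : ℝ) : ℂ) * S))) := by
  have hne : 1 - α ≠ 0 := sub_ne_zero.2 h1.symm
  have hsp := Real.sin_pos_of_mem_Ioo hs
  set g : ℝ → ℂ := fun r => ((r ^ (1 - α) : ℝ) : ℂ) with hg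
  have hgi : IntervalIntegrable (fun t => g (Real.sin t)) volume 0 Real.pi := by
    have := intervalIntegrable_sin_rpow_mul (show -1 < 1 - α by linarith)
      (continuous_const (y := (1 : ℂ)))
    simpa [hg] using this
  have hw := intervalIntegrable_comp_abs_sin_sub hgi s
  refine ⟨∫ t in (0 : ℝ)..Real.pi, sinDensity α k t * g |Real.sin (s - t)|, ?_, ?_⟩
  rotate_left
  · set c : ℂ := ((L ^ (1 - α) * Real.sin s ^ (α - 1) / (α * (1 - α)) : ℝ) : ℂ) with hc
    have lim2 : ∀ a : ℝ, Tendsto (fun y : ℝ => y ^ (2 - α) * a) (𝓝[>] 0) (𝓝 0) := by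
      intro a
      have : Tendsto (fun y : ℝ => y ^ (2 - α) * a) (𝓝 0) (𝓝 ((0 : ℝ) ^ (2 - α) * a)) :=
        (Real.continuousAt_rpow_const 0 (2 - α) (Or.inr (by linarith))).tendsto.mul_const a
      rw [Real.zero_rpow (by linarith), zero_mul] at this
      exact this.mono_left nhdsWithin_le_nhds
    have := hasFracLaplacianAt_fourierMode (Ψ := fun y => y ^ (1 - α) / (α * (1 - α)))
      (ψ := fun y => y ^ (-α) / α) (w := fun t => c * g |Real.sin (s - t)|) h0 hL k hs
      (fun y hy => ?_) (fun y hy => ?_) ?_ ?_ ?_ ?_ (hw.const_mul c) (fun t ht _ => ?_)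
    · simp only [mul_left_comm (sinDensity α k _) c, intervalIntegral.integral_const_mul] at this
      exact this
    · refine ((Real.hasDerivAt_rpow_const (p := 1 - α) (Or.inl hy.ne')).div_const _).congr_deriv ?_
      rw [show 1 - α - 1 = -α by ring]
      field_simp
    · refine ((Real.hasDerivAt_rpow_const (p := -α) (Or.inl hy.ne')).div_const _).congr_deriv ?_
      rw [show -α - 1 = -1 - α by ring]
      field_simp
    · refine (lim2 α⁻¹).congr' ?_
      filter_upwards [self_mem_nhdsWithin] with y hy
      rw [show 2 - α = 2 + -α by ring, Real.rpow_add hy, Real.rpow_two]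
      ring
    · refine (lim2 (α * (1 - α))⁻¹).congr' ?_
      filter_upwards [self_mem_nhdsWithin] with y hy
      rw [show 2 - α = 1 + (1 - α) by ring, Real.rpow_add hy, Real.rpow_one]
      ring
    · simpa using (tendsto_rpow_neg_atTop h0).div_const α
    · have := (tendsto_rpow_neg_atTop (show 0 < 1 + α by linarith)).mul_const (α * (1 - α))⁻¹
      rw [zero_mul] at this
      refine this.congr' ?_
      filter_upwards [eventually_gt_atTop 0] with y hy
      rw [show -(1 + α) = (1 - α) - 2 by ring, Real.rpow_sub hy, Real.rpow_two]
      ring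
    · have htp := Real.sin_pos_of_mem_Ioo ht
      simp only [hg, hc, sinDensity]
      rw [Real.div_rpow (by positivity) (by positivity), Real.mul_rpow hL.le (abs_nonneg _),
        Real.mul_rpow hsp.le htp.le, show α - 1 = -(1 - α) by ring, Real.rpow_neg hsp.le,
        show Real.sin t ^ α = Real.sin t * (Real.sin t ^ (1 - α))⁻¹ by
          rw [← Real.rpow_neg htp.le, ← Real.rpow_one_add' htp.le (by simpa using h0.ne')]
          congr 1; ring, Real.rpow_one]
      push_cast
      ring
  · have := hasSum_integral_sinDensity_mul h0 k hw
    simp only [integral_exp_mul_comp_abs_sin_sub] at this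
    exact this

theorem fracLaplacian_fourierMode_even {α L s : ℝ} (h0 : 0 < α) (h2 : α < 2)
    (h1 : α ≠ 1) (hL : 0 < L) {k : ℤ} (hk : Even k) (hs : s ∈ Set.Ioo 0 Real.pi) :
    Summable (evenTerm α k s) ∧
      HasFracLaplacianAt α (fourierMode L k) (L * Real.cot s)
        (((fracConst α * |Real.sin s| ^ (α - 1) /
            (8 * L ^ α * Real.tan (Real.pi * α / 2)) : ℝ) : ℂ) * ∑' l : ℤ, evenTerm α k s l) := by
  obtain ⟨S, hS, hF⟩ := hasSum_fracLaplacian_fourierMode_of_ne_one h0 h2 h1 hL k hs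
  obtain ⟨hsin, hcos⟩ := sin_ne_zero_and_cos_ne_zero h0 h2 h1
  have htan : (Real.tan (Real.pi * α / 2) : ℂ) ≠ 0 := by
    rw [Complex.ofReal_ne_zero, Real.tan_eq_sin_div_cos]
    exact div_ne_zero hsin hcos
  have ha : (α : ℂ) ≠ 0 := Complex.ofReal_ne_zero.2 h0.ne'
  have ha1 : (1 : ℂ) - α ≠ 0 := by exact_mod_cast sub_ne_zero.2 h1.symm
  have ha2 : (1 : ℂ) + α ≠ 0 := by exact_mod_cast (show 1 + α ≠ 0 by linarith)
  have hLc : (L : ℂ) ≠ 0 := Complex.ofReal_ne_zero.2 hL.ne'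
  have hLa : ((L ^ α : ℝ) : ℂ) ≠ 0 := Complex.ofReal_ne_zero.2 (Real.rpow_pos_of_pos hL α).ne'
  have hpi : (Real.pi : ℂ) ≠ 0 := Complex.ofReal_ne_zero.2 Real.pi_ne_zero
  have key := hS.mul_left (8 * (Real.tan (Real.pi * α / 2) : ℂ) / (α * (1 - α)) * (Complex.I * k))
  have e : (fun l : ℤ => 8 * (Real.tan (Real.pi * α / 2) : ℂ) / (α * (1 - α)) * (Complex.I * k) *
      (sinDensityCoeff α k l * (Complex.exp (Complex.I * 2 * l * s) *
        sinExpIntegral (1 - α) (2 * l)))) = evenTerm α k s := by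
    ext l
    have hG := sinExpIntegral_mul_even h0 h2 h1 hk l
    have : sinDensityCoeff α k l * (Complex.exp (Complex.I * 2 * l * s) *
        sinExpIntegral (1 - α) (2 * l)) = Complex.I / (Real.pi * (α + 1)) *
        ((α - 1) * k + 4 * l : ℝ) * Complex.exp (Complex.I * 2 * l * s) *
        (sinExpIntegral (α + 1) (k - 2 * l) * sinExpIntegral (1 - α) (2 * l)) := by
      rw [sinDensityCoeff]; ring
    rw [this, hG, evenTerm, add_comm (α : ℂ) 1]
    simp only [Complex.ofReal_mul, Complex.ofReal_div, Complex.ofReal_sub, Complex.ofReal_add,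
      Complex.ofReal_pow, Complex.ofReal_one, Complex.ofReal_intCast, Complex.ofReal_ofNat]
    field_simp
    rw [Complex.I_sq]
    ring
  rw [e] at key
  refine ⟨key.summable, ?_⟩
  rw [key.tsum_eq]
  convert hF using 1
  rw [abs_of_pos (Real.sin_pos_of_mem_Ioo hs), Real.rpow_sub hL 1 α, Real.rpow_one]
  simp only [Complex.ofReal_mul, Complex.ofReal_div, Complex.ofReal_sub, Complex.ofReal_one,
    Complex.ofReal_ofNat]
  generalize Real.tan (Real.pi * α / 2) = T at *
  field_simp

theorem fracLaplacian_fourierMode_odd {α L s : ℝ} (h0 : 0 < α) (h2 : α < 2)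
    (h1 : α ≠ 1) (hL : 0 < L) {k : ℤ} (hk : Odd k) (hs : s ∈ Set.Ioo 0 Real.pi) :
    Summable (oddTerm α k s) ∧
      HasFracLaplacianAt α (fourierMode L k) (L * Real.cot s)
        (Complex.I * ((fracConst α * |Real.sin s| ^ (α - 1) / (8 * L ^ α) : ℝ) : ℂ) *
            ∑' l : ℤ, oddTerm α k s l) := by
  obtain ⟨S, hS, hF⟩ := hasSum_fracLaplacian_fourierMode_of_ne_one h0 h2 h1 hL k hs
  have ha : (α : ℂ) ≠ 0 := Complex.ofReal_ne_zero.2 h0.ne'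
  have ha1 : (1 : ℂ) - α ≠ 0 := by exact_mod_cast sub_ne_zero.2 h1.symm
  have ha2 : (1 : ℂ) + α ≠ 0 := by exact_mod_cast (show 1 + α ≠ 0 by linarith)
  have hLc : (L : ℂ) ≠ 0 := Complex.ofReal_ne_zero.2 hL.ne'
  have hLa : ((L ^ α : ℝ) : ℂ) ≠ 0 := Complex.ofReal_ne_zero.2 (Real.rpow_pos_of_pos hL α).ne'
  have hpi : (Real.pi : ℂ) ≠ 0 := Complex.ofReal_ne_zero.2 Real.pi_ne_zero
  have key := hS.mul_left (8 / (α * (1 - α)) * (k : ℂ))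
  have e : (fun l : ℤ => 8 / (α * (1 - α)) * (k : ℂ) *
      (sinDensityCoeff α k l * (Complex.exp (Complex.I * 2 * l * s) *
        sinExpIntegral (1 - α) (2 * l)))) = oddTerm α k s := by
    ext l
    have hG := sinExpIntegral_mul_odd h0 h2 h1 hk l
    have : sinDensityCoeff α k l * (Complex.exp (Complex.I * 2 * l * s) *
        sinExpIntegral (1 - α) (2 * l)) = Complex.I / (Real.pi * (α + 1)) *
        ((α - 1) * k + 4 * l : ℝ) * Complex.exp (Complex.I * 2 * l * s) *
        (sinExpIntegral (α + 1) (k - 2 * l) * sinExpIntegral (1 - α) (2 * l)) := by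
      rw [sinDensityCoeff]; ring
    rw [this, hG, oddTerm, add_comm (α : ℂ) 1]
    simp only [Complex.ofReal_mul, Complex.ofReal_div, Complex.ofReal_sub, Complex.ofReal_add,
      Complex.ofReal_pow, Complex.ofReal_one, Complex.ofReal_intCast, Complex.ofReal_ofNat]
    field_simp
    rw [Complex.I_sq]
    ring
  rw [e] at key
  refine ⟨key.summable, ?_⟩
  rw [key.tsum_eq]
  convert hF using 1
  rw [abs_of_pos (Real.sin_pos_of_mem_Ioo hs), Real.rpow_sub hL 1 α, Real.rpow_one]
  simp only [Complex.ofReal_mul, Complex.ofReal_div, Complex.ofReal_sub, Complex.ofReal_one,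
    Complex.ofReal_ofNat]
  field_simp

/-! ### The case `α = 1`: the logarithmic kernel -/

theorem integral_exp_even (m : ℤ) :
    ∫ t in (0 : ℝ)..Real.pi, Complex.exp (Complex.I * (2 * m : ℤ) * t) =
      if m = 0 then (Real.pi : ℂ) else 0 := by
  split_ifs with h
  · simp [h]
  · have hc : Complex.I * ((2 * m : ℤ) : ℂ) ≠ 0 :=
      mul_ne_zero Complex.I_ne_zero (Int.cast_ne_zero.2 (by omega))
    rw [integral_exp_mul_complex hc]
    rw [show Complex.I * ((2 * m : ℤ) : ℂ) * (Real.pi : ℂ) = m * (2 * Real.pi * Complex.I) by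
      push_cast; ring, Complex.exp_int_mul_two_pi_mul_I]
    simp

theorem integral_exp_odd {q : ℤ} (hq : Odd q) :
    ∫ t in (0 : ℝ)..Real.pi, Complex.exp (Complex.I * q * t) = 2 * Complex.I / q := by
  have hq0 : (q : ℂ) ≠ 0 := by
    rw [Int.cast_ne_zero]; rintro rfl; simp at hq
  have hc : Complex.I * (q : ℂ) ≠ 0 := mul_ne_zero Complex.I_ne_zero hq0
  rw [integral_exp_mul_complex hc]
  have : Complex.exp (Complex.I * q * Real.pi) = -1 := by
    obtain ⟨m, rfl⟩ := hq
    rw [show Complex.I * ((2 * m + 1 : ℤ) : ℂ) * (Real.pi : ℂ) =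
      m * (2 * Real.pi * Complex.I) + Real.pi * Complex.I by push_cast; ring, Complex.exp_add,
      Complex.exp_int_mul_two_pi_mul_I, Complex.exp_pi_mul_I, one_mul]
  rw [this]
  simp only [Complex.ofReal_zero, mul_zero, Complex.exp_zero]
  field_simp
  rw [Complex.I_sq]
  norm_num

theorem sinExpIntegral_two (q : ℤ) :
    sinExpIntegral 2 q = (∫ t in (0 : ℝ)..Real.pi, Complex.exp (Complex.I * q * t)) / 2 -
      (∫ t in (0 : ℝ)..Real.pi, Complex.exp (Complex.I * (q + 2 : ℤ) * t)) / 4 -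
      (∫ t in (0 : ℝ)..Real.pi, Complex.exp (Complex.I * (q - 2 : ℤ) * t)) / 4 := by
  have hi : ∀ n : ℤ, IntervalIntegrable (fun t : ℝ => Complex.exp (Complex.I * n * t)) volume 0
      Real.pi := fun n => (continuous_exp_I_mul_int_mul n).intervalIntegrable _ _
  rw [← intervalIntegral.integral_div, ← intervalIntegral.integral_div,
    ← intervalIntegral.integral_div, ← intervalIntegral.integral_sub ((hi _).div_const _)
    ((hi _).div_const _), ← intervalIntegral.integral_sub (((hi _).div_const _).sub
    ((hi _).div_const _)) ((hi _).div_const _), sinExpIntegral]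
  congr 1
  ext t
  have h1 := exp_sub_exp_two q t
  have h2 := exp_sub_exp_two (q - 2) t
  have h3 := exp_sub_exp_two (q - 1) t
  rw [show q - 2 + 2 = q by ring, show q - 2 + 1 = q - 1 by ring] at h2
  rw [show q - 1 + 2 = q + 1 by ring, show q - 1 + 1 = q by ring] at h3
  rw [Real.rpow_two, Complex.ofReal_pow, Complex.ofReal_sin]
  linear_combination (1 / 4) * h1 - (1 / 4) * h2 + Complex.I * Complex.sin t / 2 * h3 +
    Complex.sin t ^ 2 * Complex.exp (Complex.I * q * t) * Complex.I_sq

theorem sinExpIntegral_two_even (m : ℤ) :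
    sinExpIntegral 2 (2 * m) = Real.pi * ((if m = 0 then 1 / 2 else 0) -
      (if m = -1 then 1 / 4 else 0) - (if m = 1 then 1 / 4 else 0)) := by
  rw [sinExpIntegral_two, show 2 * m + 2 = 2 * (m + 1) by ring, show 2 * m - 2 = 2 * (m - 1) by ring,
    integral_exp_even, integral_exp_even, integral_exp_even]
  simp only [show m + 1 = 0 ↔ m = -1 by omega, show m - 1 = 0 ↔ m = 1 by omega]
  split_ifs <;> first | omega | ring

theorem ne_of_odd {q : ℤ} (hq : Odd q) {r : ℤ} (hr : Even r) : (q : ℂ) ≠ r := by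
  rw [Ne, Int.cast_inj]
  rintro rfl
  exact (Int.not_even_iff_odd.2 hq) hr

theorem sinExpIntegral_two_odd {q : ℤ} (hq : Odd q) :
    sinExpIntegral 2 q = -4 * Complex.I / (q * ((q : ℂ) ^ 2 - 4)) := by
  have h0 : (q : ℂ) ≠ 0 := by exact_mod_cast ne_of_odd hq (r := 0) (by decide)
  have h1 : (q : ℂ) - 2 ≠ 0 := sub_ne_zero.2 (by exact_mod_cast ne_of_odd hq (r := 2) (by decide))
  have h2 : (q : ℂ) + 2 ≠ 0 := by
    have := ne_of_odd hq (r := -2) (by decide)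
    intro h
    apply this
    push_cast
    linear_combination h
  have h3 : (q : ℂ) ^ 2 - 4 ≠ 0 := by
    rw [show (q : ℂ) ^ 2 - 4 = (q - 2) * (q + 2) by ring]
    exact mul_ne_zero h1 h2
  rw [sinExpIntegral_two, integral_exp_odd hq, integral_exp_odd (hq.add_even (by decide)),
    integral_exp_odd (hq.sub_even (by decide))]
  push_cast
  rw [show (q : ℂ) ^ 2 - 4 = (q - 2) * (q + 2) by ring]
  field_simp
  ring

/-- The Fourier coefficients `∫₀^π log(sin t) e^{2ilt} dt`. -/
noncomputable def logSinExpIntegral (l : ℤ) : ℂ :=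
  ∫ t in (0 : ℝ)..Real.pi, ((Real.log (Real.sin t) : ℝ) : ℂ) * Complex.exp (Complex.I * (2 * l : ℤ) * t)

theorem intervalIntegrable_log_sin_mul {f : ℝ → ℂ} (hf : Continuous f) :
    IntervalIntegrable (fun t => ((Real.log (Real.sin t) : ℝ) : ℂ) * f t) volume 0 Real.pi := by
  have h : IntervalIntegrable (fun t => Real.log (Real.sin t)) volume 0 Real.pi :=
    intervalIntegrable_log_sin
  have h1 : IntervalIntegrable (fun t => ((Real.log (Real.sin t) : ℝ) : ℂ)) volume 0 Real.pi :=
    ⟨h.1.ofReal, h.2.ofReal⟩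
  exact h1.mul_continuousOn hf.continuousOn

/-- `sin log(sin) e^{i(2l+1)·}` vanishes at `0` and `π`, so the integral of its derivative is zero;
this is a recursion for `logSinExpIntegral`. -/
theorem logSinExpIntegral_add_one (l : ℤ) :
    ((l : ℂ) + 1) * logSinExpIntegral (l + 1) - l * logSinExpIntegral l +
      ((if l + 1 = 0 then (Real.pi : ℂ) else 0) + (if l = 0 then (Real.pi : ℂ) else 0)) / 2 = 0 := by
  have h := intervalIntegral.integral_eq_sub_of_hasDerivAt_of_le (a := 0) (b := Real.pi)
    (f := fun t => ((Real.sin t * Real.log (Real.sin t) : ℝ) : ℂ) *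
      Complex.exp (Complex.I * (2 * l + 1 : ℤ) * t))
    (f' := fun t => ((l : ℂ) + 1) * (((Real.log (Real.sin t) : ℝ) : ℂ) *
        Complex.exp (Complex.I * (2 * (l + 1) : ℤ) * t)) -
      l * (((Real.log (Real.sin t) : ℝ) : ℂ) * Complex.exp (Complex.I * (2 * l : ℤ) * t)) +
      (Complex.exp (Complex.I * (2 * (l + 1) : ℤ) * t) +
        Complex.exp (Complex.I * (2 * l : ℤ) * t)) / 2) Real.pi_pos.le ?_ ?_ ?_
  · have i1 := intervalIntegrable_log_sin_mul (continuous_exp_I_mul_int_mul (2 * (l + 1)))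
    have i2 := intervalIntegrable_log_sin_mul (continuous_exp_I_mul_int_mul (2 * l))
    have hi : ∀ n : ℤ, IntervalIntegrable (fun t : ℝ => Complex.exp (Complex.I * n * t)) volume 0
      Real.pi := fun n => (continuous_exp_I_mul_int_mul n).intervalIntegrable _ _
    rw [intervalIntegral.integral_add ((i1.const_mul _).sub (i2.const_mul _))
      (((hi _).add (hi _)).div_const _), intervalIntegral.integral_sub (i1.const_mul _)
      (i2.const_mul _), intervalIntegral.integral_const_mul, intervalIntegral.integral_const_mul,
      intervalIntegral.integral_div, intervalIntegral.integral_add (hi _) (hi _),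
      integral_exp_even, integral_exp_even] at h
    simpa [logSinExpIntegral] using h
  · refine Continuous.continuousOn ?_
    have : Continuous fun t => Real.sin t * Real.log (Real.sin t) :=
      Real.continuous_mul_log.comp Real.continuous_sin
    fun_prop
  · intro t ht
    have hs := (Real.sin_pos_of_mem_Ioo ht).ne'
    have h1 := ((Real.hasDerivAt_sin t).mul ((Real.hasDerivAt_sin t).log hs)).ofReal_comp.mul
      (hasDerivAt_exp_I_mul_int_mul (2 * l + 1) t)
    refine h1.congr_deriv ?_
    have e1 := exp_add_exp_two (2 * l) t
    have e2 := exp_sub_exp_two (2 * l) t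
    rw [show 2 * (l + 1) = 2 * l + 2 by ring]
    rw [mul_div_cancel₀ _ hs, Pi.mul_apply]
    push_cast at e1 e2 ⊢
    linear_combination (-(1 / 2 : ℂ) * (1 + (Real.log (Real.sin t) : ℂ))) * e1 -
      ((2 * l + 1) / 2 * (Real.log (Real.sin t) : ℂ)) * e2
  · have i1 := intervalIntegrable_log_sin_mul (continuous_exp_I_mul_int_mul (2 * (l + 1)))
    have i2 := intervalIntegrable_log_sin_mul (continuous_exp_I_mul_int_mul (2 * l))
    have hi : ∀ n : ℤ, IntervalIntegrable (fun t : ℝ => Complex.exp (Complex.I * n * t)) volume 0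
      Real.pi := fun n => (continuous_exp_I_mul_int_mul n).intervalIntegrable _ _
    exact ((i1.const_mul _).sub (i2.const_mul _)).add (((hi _).add (hi _)).div_const _)

theorem logSinExpIntegral_neg (l : ℤ) :
    logSinExpIntegral (-l) = (starRingEnd ℂ) (logSinExpIntegral l) := by
  rw [logSinExpIntegral, logSinExpIntegral, intervalIntegral.integral_of_le Real.pi_pos.le,
    intervalIntegral.integral_of_le Real.pi_pos.le, ← integral_conj]
  congr 1
  ext t
  rw [map_mul, Complex.conj_ofReal, ← Complex.exp_conj]
  congr 2
  rw [map_mul, map_mul, Complex.conj_I, Complex.conj_ofReal, map_intCast]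
  push_cast
  ring

/-- `∫₀^π log(sin t) e^{2ilt} dt = -π / (2 |l|)` for `l ≠ 0`, in a form that is also true for `l = 0`. -/
theorem mul_logSinExpIntegral (l : ℤ) :
    (l : ℂ) * logSinExpIntegral l = -(Real.pi / 2) * (Real.sign (l : ℝ) : ℂ) := by
  have key : ∀ n : ℕ, ((n : ℂ) + 1) * logSinExpIntegral ((n : ℤ) + 1) = -(Real.pi / 2) := by
    intro n
    induction n with
    | zero =>
      have := logSinExpIntegral_add_one 0
      simp only [zero_add, one_ne_zero, if_false, if_true, Int.cast_zero, zero_mul, sub_zero] at this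
      push_cast
      simp only [zero_add]
      linear_combination this
    | succ n ih =>
      have := logSinExpIntegral_add_one ((n : ℤ) + 1)
      rw [if_neg (by omega), if_neg (by omega)] at this
      push_cast at this ⊢
      linear_combination this + ih
  rcases lt_trichotomy l 0 with h | rfl | h
  · obtain ⟨n, hn⟩ := Int.eq_ofNat_of_zero_le (show 0 ≤ -l - 1 by omega)
    obtain rfl : l = -((n : ℤ) + 1) := by omega
    have hc := congrArg (starRingEnd ℂ) (key n)
    rw [logSinExpIntegral_neg, Real.sign_of_neg (by exact_mod_cast h)]
    simp only [map_mul, map_add, map_neg, map_div₀, Complex.conj_natCast, map_one,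
      Complex.conj_ofReal, map_ofNat] at hc
    push_cast
    linear_combination -hc
  · simp
  · obtain ⟨n, hn⟩ := Int.eq_ofNat_of_zero_le (show 0 ≤ l - 1 by omega)
    obtain rfl : l = (n : ℤ) + 1 := by omega
    rw [Real.sign_of_pos (by exact_mod_cast h)]
    push_cast
    rw [key n]
    ring

theorem fracConst_one : fracConst 1 = 1 / Real.pi := by
  rw [fracConst, show (1 : ℝ) / 2 + 1 / 2 = 1 by norm_num, show (1 : ℝ) - 1 / 2 = 1 / 2 by norm_num,
    Real.Gamma_one, Real.Gamma_one_half_eq, Real.mul_self_sqrt Real.pi_pos.le]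
  simp

/-- For `α = 1` the kernel is `log`, a twofold primitive of `-y^(-2)`. -/
theorem hasSum_fracLaplacian_fourierMode_one {L s : ℝ} (hL : 0 < L) (k : ℤ)
    (hs : s ∈ Set.Ioo 0 Real.pi) :
    ∃ S : ℂ, HasSum (fun l : ℤ => (Real.sign (l : ℝ) : ℂ) * sinExpIntegral 2 (k - 2 * l) *
        (Complex.exp (Complex.I * 2 * l * s) - 1)) S ∧
      HasFracLaplacianAt 1 (fourierMode L k) (L * Real.cot s) (k / (Real.pi * L) * S) := by
  have hsp := Real.sin_pos_of_mem_Ioo hs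
  have hpi : (Real.pi : ℂ) ≠ 0 := Complex.ofReal_ne_zero.2 Real.pi_ne_zero
  have hLc : (L : ℂ) ≠ 0 := Complex.ofReal_ne_zero.2 hL.ne'
  set g : ℝ → ℂ := fun r => ((Real.log r : ℝ) : ℂ) with hg
  have hgi : IntervalIntegrable (fun t => g (Real.sin t)) volume 0 Real.pi := by
    simpa [hg] using intervalIntegrable_log_sin_mul (continuous_const (y := (1 : ℂ)))
  have hgs := intervalIntegrable_comp_abs_sin_sub hgi s
  set c : ℂ := ((Real.log (L / Real.sin s) : ℝ) : ℂ) with hc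
  set w : ℝ → ℂ := fun t => g |Real.sin (s - t)| - g (Real.sin t) + c with hw
  have hwi : IntervalIntegrable w volume 0 Real.pi :=
    (hgs.sub hgi).add intervalIntegrable_const
  refine ⟨Complex.I * ∫ t in (0 : ℝ)..Real.pi, sinDensity 1 k t * w t, ?_, ?_⟩
  · have hI : ∀ l : ℤ, ∫ t in (0 : ℝ)..Real.pi, Complex.exp (Complex.I * (2 * l : ℤ) * t) * w t =
        (Complex.exp (Complex.I * 2 * l * s) - 1) * logSinExpIntegral l +
          c * (if l = 0 then (Real.pi : ℂ) else 0) := by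
      intro l
      have hco := (continuous_exp_I_mul_int_mul (2 * l)).continuousOn (s := Set.uIcc 0 Real.pi)
      simp only [hw, mul_add, mul_sub]
      rw [intervalIntegral.integral_add ((hgs.continuousOn_mul hco).sub (hgi.continuousOn_mul hco))
        (intervalIntegrable_const.continuousOn_mul hco), intervalIntegral.integral_sub
        (hgs.continuousOn_mul hco) (hgi.continuousOn_mul hco), integral_exp_mul_comp_abs_sin_sub,
        intervalIntegral.integral_mul_const, integral_exp_even]
      simp only [mul_comm (Complex.exp _) (g _)]
      simp only [hg]
      rw [← logSinExpIntegral]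
      ring
    have hS := (hasSum_integral_sinDensity_mul one_pos k hwi).mul_left Complex.I
    refine hS.congr_fun fun l => ?_
    have hJ := mul_logSinExpIntegral l
    rw [hI, sinDensityCoeff, show (1 : ℝ) + 1 = 2 by norm_num]
    -- The constant part of `w` only meets the coefficient with `l = 0`, which vanishes.
    have h0 : (l : ℂ) * (if l = 0 then (Real.pi : ℂ) else 0) = 0 := by
      split_ifs with h
      · simp [h]
      · simp
    generalize (if l = 0 then (Real.pi : ℂ) else 0) = d at *
    push_cast
    generalize logSinExpIntegral l = J at *
    field_simp
    linear_combination (-4 * sinExpIntegral 2 (k - 2 * l) *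
      (Complex.exp (Complex.I * 2 * l * s) - 1) * Complex.I ^ 2) * hJ -
      (4 * sinExpIntegral 2 (k - 2 * l) * c * Complex.I ^ 2) * h0 +
      2 * (Real.sign (l : ℝ) : ℂ) * Real.pi * sinExpIntegral 2 (k - 2 * l) *
      (Complex.exp (Complex.I * 2 * l * s) - 1) * Complex.I_sq
  · have := hasFracLaplacianAt_fourierMode (Ψ := Real.log) (ψ := fun y => y⁻¹) (w := w)
      one_pos hL k hs (fun y hy => Real.hasDerivAt_log hy.ne') (fun y hy => ?_) ?_ ?_ ?_ ?_ hwi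
      (fun t ht hts => ?_)
    · convert this using 1
      rw [fracConst_one]
      push_cast
      field_simp
    · refine (hasDerivAt_inv hy.ne').congr_deriv ?_
      rw [show (-1 - 1 : ℝ) = -2 by norm_num, Real.rpow_neg hy.le, Real.rpow_two]
    · have : Tendsto (fun y : ℝ => y) (𝓝[>] 0) (𝓝 0) := tendsto_id.mono_left nhdsWithin_le_nhds
      refine this.congr' ?_
      filter_upwards [self_mem_nhdsWithin] with y hy
      have : y ≠ 0 := ne_of_gt hy
      field_simp
    · have := Real.continuous_mul_log.tendsto 0
      rw [zero_mul] at this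
      exact this.mono_left nhdsWithin_le_nhds
    · exact tendsto_inv_atTop_zero
    · have h1 := Real.isLittleO_log_id_atTop.tendsto_div_nhds_zero
      have := h1.mul tendsto_inv_atTop_zero
      rw [zero_mul] at this
      refine this.congr' ?_
      filter_upwards [eventually_gt_atTop 0] with y hy
      simp only [id]
      field_simp
    · have htp := Real.sin_pos_of_mem_Ioo ht
      -- Here `t ≠ s` matters: `log 0 = 0` would break the additivity of `log`.
      have hne : Real.sin (s - t) ≠ 0 := by
        rcases lt_or_gt_of_ne hts with h | h
        · exact (Real.sin_pos_of_pos_of_lt_pi (by linarith) (by linarith [ht.1, hs.2])).ne'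
        · exact (Real.sin_neg_of_neg_of_neg_pi_lt (by linarith) (by linarith [ht.2, hs.1])).ne
      have habs : |Real.sin (s - t)| ≠ 0 := abs_ne_zero.2 hne
      simp only [hw, hg, hc]
      congr 1
      rw [show L * |Real.sin (s - t)| / (Real.sin s * Real.sin t) =
        (L / Real.sin s) * |Real.sin (s - t)| / Real.sin t by field_simp,
        Real.log_div (by positivity) htp.ne', Real.log_mul (by positivity) habs]
      push_cast
      ring

theorem fracLaplacian_one_fourierMode_even {L s : ℝ} (hL : 0 < L) {k : ℤ} (hk : Even k)
    (hs : s ∈ Set.Ioo 0 Real.pi) :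
    HasFracLaplacianAt 1 (fourierMode L k) (L * Real.cot s)
      (((|(k : ℝ)| * Real.sin s ^ 2 / L : ℝ) : ℂ) * Complex.exp (Complex.I * k * s)) := by
  obtain ⟨S, hS, hF⟩ := hasSum_fracLaplacian_fourierMode_one hL k hs
  have hpi : (Real.pi : ℂ) ≠ 0 := Complex.ofReal_ne_zero.2 Real.pi_ne_zero
  have hLc : (L : ℂ) ≠ 0 := Complex.ofReal_ne_zero.2 hL.ne'
  obtain ⟨n, rfl⟩ := hk
  have hrw : ∀ l : ℤ, n + n - 2 * l = 2 * (n - l) := fun l => by ring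
  simp only [hrw, sinExpIntegral_two_even] at hS
  have hfin := hasSum_sum_of_ne_finset_zero (f := fun l : ℤ => (Real.sign (l : ℝ) : ℂ) *
    (Real.pi * ((if n - l = 0 then 1 / 2 else 0) -
      (if n - l = -1 then 1 / 4 else 0) - (if n - l = 1 then 1 / 4 else 0))) *
        (Complex.exp (Complex.I * 2 * l * s) - 1)) (s := {n - 1, n, n + 1}) (L := .unconditional ℤ) (by
    intro l hl
    simp only [Finset.mem_insert, Finset.mem_singleton, not_or] at hl
    rw [if_neg (by omega), if_neg (by omega), if_neg (by omega)]
    simp)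
  have hSv := hS.unique hfin
  rw [Finset.sum_insert (by simp; omega), Finset.sum_insert (by simp), Finset.sum_singleton,
    if_neg (by omega), if_neg (by omega), if_pos (by omega), if_pos (by omega), if_neg (by omega),
    if_neg (by omega), if_neg (by omega), if_pos (by omega), if_neg (by omega)] at hSv
  convert hF using 1
  -- `sign m` may be replaced by `sign n` at the neighbours of `n`: they have the same sign unless
  -- `m = 0`, and then the exponential factor vanishes.
  have hsg : ∀ m : ℤ, m = n - 1 ∨ m = n + 1 → n ≠ 0 →
      (Real.sign (m : ℝ) : ℂ) * (Complex.exp (Complex.I * 2 * m * s) - 1) =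
      (Real.sign (n : ℝ) : ℂ) * (Complex.exp (Complex.I * 2 * m * s) - 1) := by
    intro m hm hn
    rcases eq_or_ne m 0 with rfl | hm0
    · simp
    rcases lt_or_gt_of_ne hn with h | h
    · rw [Real.sign_of_neg (by exact_mod_cast (show m < 0 by omega)),
        Real.sign_of_neg (by exact_mod_cast h)]
    · rw [Real.sign_of_pos (by exact_mod_cast (show 0 < m by omega)),
        Real.sign_of_pos (by exact_mod_cast h)]
  rcases eq_or_ne n 0 with rfl | hn
  · simp
  have a1 := hsg (n - 1) (Or.inl rfl) hn
  have a2 := hsg (n + 1) (Or.inr rfl) hn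
  have hE : Complex.exp (Complex.I * 2 * (n - 1 : ℤ) * s) +
      Complex.exp (Complex.I * 2 * (n + 1 : ℤ) * s) =
      (2 - 4 * Complex.sin s ^ 2) * Complex.exp (Complex.I * 2 * n * s) := by
    have e1 := exp_sub_exp_two (2 * n) s
    have e2 := exp_sub_exp_two (2 * n - 2) s
    have e3 := exp_sub_exp_two (2 * n - 1) s
    rw [show 2 * n - 2 + 2 = 2 * n by ring, show 2 * n - 2 + 1 = 2 * n - 1 by ring] at e2
    rw [show 2 * n - 1 + 2 = 2 * n + 1 by ring, show 2 * n - 1 + 1 = 2 * n by ring] at e3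
    rw [show Complex.I * 2 * ((n - 1 : ℤ) : ℂ) * s = Complex.I * (2 * n - 2 : ℤ) * s by
      push_cast; ring, show Complex.I * 2 * ((n + 1 : ℤ) : ℂ) * s = Complex.I * (2 * n + 2 : ℤ) * s by
      push_cast; ring, show Complex.I * 2 * (n : ℂ) * s = Complex.I * (2 * n : ℤ) * s by
      push_cast; ring]
    linear_combination e1 - e2 + 2 * Complex.I * Complex.sin s * e3 +
      4 * Complex.sin s ^ 2 * Complex.exp (Complex.I * (2 * n : ℤ) * s) * Complex.I_sq
  have habs : ((|((n + n : ℤ) : ℝ)| : ℝ) : ℂ) = (Real.sign (n : ℝ) : ℂ) * (2 * n) := by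
    rcases lt_or_gt_of_ne hn with h | h
    · rw [Real.sign_of_neg (by exact_mod_cast h),
        abs_of_neg (by exact_mod_cast (show n + n < 0 by omega))]
      push_cast; ring
    · rw [Real.sign_of_pos (by exact_mod_cast h),
        abs_of_pos (by exact_mod_cast (show 0 < n + n by omega))]
      push_cast; ring
  have hSn : S = (Real.sign (n : ℝ) : ℂ) *
      (Real.pi * Complex.sin s ^ 2 * Complex.exp (Complex.I * 2 * n * s)) := by
    rw [hSv]
    linear_combination (-(Real.pi / 4 : ℂ)) * a1 - (Real.pi / 4 : ℂ) * a2 -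
      (Real.sign (n : ℝ) : ℂ) * (Real.pi / 4) * hE
  rw [Complex.ofReal_div, Complex.ofReal_mul, habs, hSn,
    show Complex.I * ((n + n : ℤ) : ℂ) * s = Complex.I * 2 * n * s by push_cast; ring]
  push_cast
  field_simp
  ring

/-- The contribution of `log sin` for odd `k`: each term is a difference `h(l) - h(l+1)` up to sign, so
the positive and the negative half of the series telescope to `h(1)` and `h(0)`. -/
theorem hasSum_sign_div {k : ℤ} (hk : Odd k) :
    HasSum (fun l : ℤ => 4 * (Real.sign (l : ℝ) : ℂ) /
      (((k : ℂ) - 2 * l) * (((k : ℂ) - 2 * l) ^ 2 - 4))) (-2 / ((k : ℂ) ^ 2 - 4)) := by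
  set D : ℤ → ℂ := fun l => 4 * (Real.sign (l : ℝ) : ℂ) /
      (((k : ℂ) - 2 * l) * (((k : ℂ) - 2 * l) ^ 2 - 4)) with hD
  have hodd : ∀ l : ℤ, Odd (k - 2 * l) := fun l => hk.sub_even (even_two_mul l)
  have hsum : Summable D := by
    have := summable_affine_mul_sinExpIntegral (p := 2) (by norm_num) k 1 0
    refine Summable.of_norm_bounded this fun l => ?_
    have e : D l = Complex.I * (Real.sign (l : ℝ) : ℂ) * sinExpIntegral 2 (k - 2 * l) := by
      rw [sinExpIntegral_two_odd (hodd l)]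
      simp only [hD]
      push_cast
      linear_combination (4 * (Real.sign (l : ℝ) : ℂ) /
        (((k : ℂ) - 2 * l) * (((k : ℂ) - 2 * l) ^ 2 - 4))) * Complex.I_sq
    have hs : ‖(Real.sign (l : ℝ) : ℂ)‖ ≤ 1 := by
      rw [Complex.norm_real]
      rcases Real.sign_apply_eq (l : ℝ) with h | h | h <;> rw [h] <;> simp
    rw [e, norm_mul, norm_mul, Complex.norm_I, one_mul, norm_mul]
    refine mul_le_mul_of_nonneg_right ?_ (norm_nonneg _)
    simpa using hs
  set h : ℤ → ℂ := fun l => 1 / 2 * (1 / ((k : ℂ) - 2 * l + 2) - 1 / ((k : ℂ) - 2 * l)) with hh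
  have ne : ∀ l c : ℤ, (k : ℂ) - 2 * l + 2 * c ≠ 0 := by
    intro l c
    have := ne_of_odd ((hodd l).add_even (even_two_mul c)) (r := 0) (by decide)
    push_cast at this
    exact this
  have hstep : ∀ l : ℤ, D l = (Real.sign (l : ℝ) : ℂ) * (h l - h (l + 1)) := by
    intro l
    have n0 := ne l 0
    have n1 := ne l 1
    have n2 := ne l (-1)
    simp only [hD, hh]
    push_cast at n0 n1 n2 ⊢
    rw [mul_zero, add_zero] at n0
    rw [mul_one] at n1
    rw [show (k : ℂ) - 2 * l + 2 * -1 = k - 2 * l - 2 by ring] at n2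
    rw [show (k : ℂ) - 2 * (l + 1) + 2 = k - 2 * l by ring,
      show (k : ℂ) - 2 * (l + 1) = k - 2 * l - 2 by ring,
      show ((k : ℂ) - 2 * l) ^ 2 - 4 = (k - 2 * l + 2) * (k - 2 * l - 2) by ring]
    generalize (k : ℂ) - 2 * l = q at *
    field_simp
    ring
  have lim : ∀ c : ℤ, Tendsto (fun n : ℕ => 1 / (2 * (n : ℂ) + c)) atTop (𝓝 0) := by
    intro c
    have h1 : Tendsto (fun n : ℕ => 2 * (n : ℝ) + c) atTop atTop :=
      tendsto_atTop_add_const_right _ _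
        (tendsto_natCast_atTop_atTop.const_mul_atTop (by norm_num))
    have h2 := (Complex.continuous_ofReal.tendsto 0).comp (tendsto_inv_atTop_zero.comp h1)
    rw [Complex.ofReal_zero] at h2
    refine h2.congr fun n => ?_
    simp
  have hpos : HasSum (fun n : ℕ => D n) (h 1) := by
    have hs1 : Summable fun n : ℕ => D n := hsum.comp_injective Nat.cast_injective
    rw [← hasSum_nat_add_iff' 1]
    have hs2 := (summable_nat_add_iff 1).2 hs1
    have hz : h 1 - ∑ i ∈ Finset.range 1, D (i : ℕ) = h 1 := by simp [hD]
    rw [hz, hs2.hasSum_iff_tendsto_nat]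
    have e : ∀ n : ℕ, ∑ i ∈ Finset.range n, D ((i + 1 : ℕ) : ℤ) = h 1 - h ((n : ℤ) + 1) := by
      intro n
      have := Finset.sum_range_sub' (fun i : ℕ => h ((i : ℤ) + 1)) n
      simp only [Nat.cast_zero, zero_add] at this
      rw [← this]
      refine Finset.sum_congr rfl fun i _ => ?_
      rw [hstep, Real.sign_of_pos (by positivity)]
      push_cast
      ring
    simp only [e]
    have l1 : Tendsto (fun n : ℕ => h ((n : ℤ) + 1)) atTop (𝓝 0) := by
      have := (((lim (2 - k)).sub (lim (-k)))).const_mul (1 / 2)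
      rw [sub_zero, mul_zero] at this
      refine this.congr fun n => ?_
      simp only [hh]
      push_cast
      rw [show (k : ℂ) - 2 * (n + 1) + 2 = -(2 * n + -k) by ring,
        show (k : ℂ) - 2 * (n + 1) = -(2 * n + (2 - k)) by ring, div_neg, div_neg]
      ring
    simpa using l1.const_sub (h 1)
  have hneg : HasSum (fun n : ℕ => D (-((n : ℤ) + 1))) (h 0) := by
    have hs1 : Summable fun n : ℕ => D (-((n : ℤ) + 1)) :=
      hsum.comp_injective (i := fun n : ℕ => -((n : ℤ) + 1)) fun a b hab => by
        simp only at hab; omega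
    rw [hs1.hasSum_iff_tendsto_nat]
    have e : ∀ n : ℕ, ∑ i ∈ Finset.range n, D (-((i : ℤ) + 1)) = h 0 - h (-(n : ℤ)) := by
      intro n
      have := Finset.sum_range_sub' (fun i : ℕ => h (-(i : ℤ))) n
      simp only [Nat.cast_zero, neg_zero] at this
      rw [← this]
      refine Finset.sum_congr rfl fun i _ => ?_
      rw [hstep, Real.sign_of_neg (by push_cast; linarith [(i.cast_nonneg : (0 : ℝ) ≤ i)]),
        show -((i : ℤ) + 1) + 1 = -i by ring]
      push_cast
      ring
    simp only [e]
    have l1 : Tendsto (fun n : ℕ => h (-(n : ℤ))) atTop (𝓝 0) := by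
      have := (((lim (2 + k)).sub (lim k))).const_mul (1 / 2)
      rw [sub_zero, mul_zero] at this
      refine this.congr fun n => ?_
      simp only [hh]
      push_cast
      rw [show (k : ℂ) - 2 * (-n) + 2 = 2 * n + (2 + k) by ring,
        show (k : ℂ) - 2 * (-n) = 2 * n + k by ring]
    simpa using l1.const_sub (h 0)
  have := hpos.of_nat_of_neg_add_one hneg
  convert this using 1
  have n0 := ne 0 0
  have n1 := ne 0 1
  have n2 := ne 0 (-1)
  simp only [hh]
  push_cast at n0 n1 n2 ⊢
  simp only [mul_zero, sub_zero, add_zero, mul_one, mul_neg] at n0 n1 n2 ⊢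
  rw [← sub_eq_add_neg] at n2
  rw [show (k : ℂ) - 2 + 2 = k by ring, show (k : ℂ) ^ 2 - 4 = (k + 2) * (k - 2) by ring]
  field_simp
  ring

theorem fracLaplacian_one_fourierMode_odd {L s : ℝ} (hL : 0 < L) {k : ℤ} (hk : Odd k)
    (hs : s ∈ Set.Ioo 0 Real.pi) :
    Summable (oddTermOne k s) ∧
      HasFracLaplacianAt 1 (fourierMode L k) (L * Real.cot s)
        (Complex.I * k / (L * Real.pi) *
          (-2 / ((k : ℂ) ^ 2 - 4) - ∑' l : ℤ, oddTermOne k s l)) := by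
  obtain ⟨S, hS, hF⟩ := hasSum_fracLaplacian_fourierMode_one hL k hs
  have hD := hasSum_sign_div hk
  have hodd : ∀ l : ℤ, Odd (k - 2 * l) := fun l => hk.sub_even (even_two_mul l)
  have key := (hS.mul_left Complex.I).add hD
  have e : (fun l : ℤ => Complex.I * ((Real.sign (l : ℝ) : ℂ) * sinExpIntegral 2 (k - 2 * l) *
      (Complex.exp (Complex.I * 2 * l * s) - 1)) + 4 * (Real.sign (l : ℝ) : ℂ) /
      (((k : ℂ) - 2 * l) * (((k : ℂ) - 2 * l) ^ 2 - 4))) = oddTermOne k s := by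
    ext l
    rw [sinExpIntegral_two_odd (hodd l), oddTermOne]
    push_cast
    linear_combination (-4 * (Real.sign (l : ℝ) : ℂ) * (Complex.exp (Complex.I * 2 * l * s) - 1) /
      (((k : ℂ) - 2 * l) * (((k : ℂ) - 2 * l) ^ 2 - 4))) * Complex.I_sq
  rw [e] at key
  refine ⟨key.summable, ?_⟩
  rw [key.tsum_eq]
  convert hF using 1
  rw [mul_comm (L : ℂ)]
  linear_combination (-(k : ℂ) / (Real.pi * L) * S) * Complex.I_sq

theorem theorem1 (L : ℝ) (hL : 0 < L) (k : ℤ) (s : ℝ) (hs : s ∈ Set.Ioo 0 Real.pi) :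
    (∀ α : ℝ, α ∈ Set.Ioo (0 : ℝ) 1 ∪ Set.Ioo (1 : ℝ) 2 →
      (Even k →
        Summable (evenTerm α k s) ∧
        HasFracLaplacianAt α (fourierMode L k) (L * Real.cot s)
          (((fracConst α * |Real.sin s| ^ (α - 1) /
              (8 * L ^ α * Real.tan (Real.pi * α / 2)) : ℝ) : ℂ) *
            ∑' l : ℤ, evenTerm α k s l)) ∧
      (Odd k →
        Summable (oddTerm α k s) ∧
        HasFracLaplacianAt α (fourierMode L k) (L * Real.cot s)
          (Complex.I * ((fracConst α * |Real.sin s| ^ (α - 1) / (8 * L ^ α) : ℝ) : ℂ) *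
            ∑' l : ℤ, oddTerm α k s l))) ∧
    (Even k →
      HasFracLaplacianAt 1 (fourierMode L k) (L * Real.cot s)
        (((|(k : ℝ)| * Real.sin s ^ 2 / L : ℝ) : ℂ) * Complex.exp (Complex.I * k * s))) ∧
    (Odd k →
      Summable (oddTermOne k s) ∧
      HasFracLaplacianAt 1 (fourierMode L k) (L * Real.cot s)
        (Complex.I * k / (L * Real.pi) *
          (-2 / ((k : ℂ) ^ 2 - 4) - ∑' l : ℤ, oddTermOne k s l))) := by
  refine ⟨fun α hα => ?_, fun hk => fracLaplacian_one_fourierMode_even hL hk hs,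
    fun hk => fracLaplacian_one_fourierMode_odd hL hk hs⟩
  obtain ⟨h0, h2, h1⟩ : 0 < α ∧ α < 2 ∧ α ≠ 1 := by
    rcases hα with h | h
    · exact ⟨h.1, by linarith [h.2], h.2.ne⟩
    · exact ⟨by linarith [h.1], h.2, h.1.ne'⟩
  exact ⟨fun hk => fracLaplacian_fourierMode_even h0 h2 h1 hL hk hs,
    fun hk => fracLaplacian_fourierMode_odd h0 h2 h1 hL hk hs⟩
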